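/- **Setting.** Let $n\ge 2$, $1<p,q<+\infty$. Let $\Omega\subset\mathbb R^n$ be a bounded domain (open, connected, nonempty) with Lipschitz boundary. Let $A$ be an open set (possibly empty) with Lipschitz boundary and finitely many connected components such that $\overline A\subset\Omega$ and $B:=\Omega\setminus\overline A$ is still a domain. $W^{1,p}_0(\Omega)$ denotes the closure of $C^1_c(\Omega)$ in $W^{1,p}(\Omega)$. The trace space $X^p(\partial\Omega)$ is identified with $W^{1,p}(\Omega)$ modulo $W_0^{1,p}(\Omega)$, and $X^p_\diamond(\partial\Omega)$ is the set of its elements whose trace has vanishing integral over $\partial\Omega$ with respect to the $(n-1)$-dimensional Hausdorff measure. Let $f\in X_\diamond^p(\partial\Omega)$, represented by a function in $W^{1,p}(\Omega)$. Let $\sigma(x,E)\in[-\infty,+\infty]$ be a conductivity, $x\in\Omega$, $E\ge 0$, and let $\sigma_B,\sigma_A$ be its restrictions to $B$ and $A$. Consider the following assumptions; in (P3) and (Q2) the field $\sigma(x,|\mathbf E|)\mathbf E$ is understood to be $0$ at $\mathbf E=0$. - (P1) $\sigma_B$ and $\sigma_A$ are Carathéodory functions: measurable in $x$ for every $E>0$,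 and continuous in $E\in(0,+\infty)$ for a.e. $x$. - (P2) There are constants $0<\underline\sigma\le\overline\sigma$ and $E_0>0$ such that for a.e. $x\in B$ and all $E>0$, $$\underline\sigma\Big(\tfrac{E}{E_0}\Big)^{p-2}\le\sigma_B(x,E)\le\begin{cases}\overline\sigma\big[1+(E/E_0)^{p-2}\big]& p\ge2,\\ \overline\sigma\,(E/E_0)^{p-2}&1<p<2.\end{cases}$$ - (P3) There is $\kappa>0$ such that for a.e. $x\in B$ and all $\mathbf E_1,\mathbf E_2\in\mathbb R^n$, with $E_i=|\mathbf E_i|$, $$(\sigma_B(x,E_2)\mathbf E_2-\sigma_B(x,E_1)\mathbf E_1)\cdot(\mathbf E_2-\mathbf E_1)\ge\begin{cases}\kappa|\mathbf E_2-\mathbf E_1|^p& p\ge2,\\ \kappa(1+|\mathbf E_2|^2+|\mathbf E_1|^2)^{\frac{p-2}{2}}|\mathbf E_2-\mathbf E_1|^2&1<p<2.\end{cases}$$ - (Q1), (Q2) The conditions (P2), (P3) with $B,\sigma_B,p$ replaced by $A,\sigma_A,q$ (and possibly other constants). - (R) $\sigma_A(x,E)=0$ for a.e. $x\in A$ and all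 $E>0$ (perfect insulator). - (S) $\sigma_A(x,E)=+\infty$ for a.e. $x\in A$ and all $E>0$ (perfect conductor). Put $Q_B(x,E)=\int_0^E\sigma_B(x,\xi)\,\xi\,d\xi$ and $Q_A(x,E)=\int_0^E\sigma_A(x,\xi)\,\xi\,d\xi$. **Theorem 2.1.** Assume (P1), (P2), (P3). 1. If $A=\emptyset$, or 2. if (Q1) and (Q2) hold, then the problem $$\min\Big\{\int_B Q_B(x,|\nabla u|)\,dx+\int_A Q_A(x,|\nabla u|)\,dx\ :\ u\in W^{1,p}(\Omega)\cup W^{1,q}(\Omega),\ u-f\in W^{1,p}_0(\Omega)\cup W^{1,q}_0(\Omega)\Big\}$$ has a unique solution. 3. If (R) holds, then the problem $$\min\Big\{\int_B Q_B(x,|\nabla u|)\,dx\ :\ u\in W^{1,p}(B),\ u=f\text{ on }\partial\Omega\Big\}$$ has a unique solution, where $u=f$ on $\partial\Omega$ means that $u-f|_B$ lies in the closure in $W^{1,p}(B)$ of the restrictions to $B$ of functions in $C_c^1(\Omega)$. 4. If (S) holds, then the problem $$\min\Big\{\int_B Q_B(x,|\nabla u|)\,dx\ :\ u\in W^{1,p}(\Omega),\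 u-f\in W^{1,p}_0(\Omega),\ |\nabla u|=0\text{ a.e. in }A\Big\}$$ has a unique solution. In each case the minimum is attained and finite, and uniqueness is meant up to equality a.e. (in $\Omega$ in cases 1, 2, 4 and in $B$ in case 3). -/

import Mathlib

open MeasureTheory Set Filter Topology
open scoped ENNReal

noncomputable section

namespace TwoPhase

/-- The Euclidean space `ℝⁿ`. -/
abbrev E (n : ℕ) : Type := EuclideanSpace ℝ (Fin n)

/-! ### Geometry -/

/-- `U` has a Lipschitz continuous boundary: near each boundary point `U` is, in the direction of
some unit vector `e`, the strict epigraph of a Lipschitz function of the component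
`x - ⟪e, x⟫ e` of `x` orthogonal to `e`. -/
def HasLipschitzBoundary {n : ℕ} (U : Set (E n)) : Prop :=
  ∀ x₀ ∈ frontier U, ∃ r : ℝ, 0 < r ∧ ∃ e : E n, ‖e‖ = 1 ∧
    ∃ (K : NNReal) (γ : E n → ℝ), LipschitzWith K γ ∧
      ∀ x ∈ Metric.ball x₀ r, (x ∈ U ↔ γ (x - inner ℝ e x • e) < inner ℝ e x)

/-- The region occupied by the outer phase, `B = Ω \ closure A`. -/
def outerPhase {n : ℕ} (Ω A : Set (E n)) : Set (E n) := Ω \ closure A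

/-- Standing assumptions on the conductor `Ω` and the inner phase `A` (possibly empty):
`Ω` is a bounded Lipschitz domain, `A` is open with Lipschitz boundary, has finitely many connected
components and is compactly contained in `Ω`, and `Ω \ closure A` is still a domain. -/
structure IsTwoPhaseDomain {n : ℕ} (Ω A : Set (E n)) : Prop where
  isOpen : IsOpen Ω
  isConnected : IsConnected Ω
  isBounded : Bornology.IsBounded Ω
  lipschitz : HasLipschitzBoundary Ω
  isOpen_inner : IsOpen A
  closure_inner_subset : closure A ⊆ Ω
  lipschitz_inner : HasLipschitzBoundary A
  finite_components : Finite (ConnectedComponents A)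
  isConnected_outer : IsConnected (outerPhase Ω A)

/-! ### Sobolev spaces -/

/-- `G` is the weak gradient of `u` in the open set `U`. -/
def HasWeakGradient {n : ℕ} (U : Set (E n)) (u : E n → ℝ) (G : E n → E n) : Prop :=
  LocallyIntegrableOn u U volume ∧ LocallyIntegrableOn G U volume ∧
    ∀ φ : E n → ℝ, ContDiff ℝ (⊤ : ℕ∞) φ → HasCompactSupport φ → tsupport φ ⊆ U → ∀ v : E n,
      ∫ x in U, u x * fderiv ℝ φ x v = - ∫ x in U, inner ℝ (G x) v * φ x

open scoped Classical in
/-- The weak gradient of `u` in `U` (a representative of the a.e. class, which is unique); it is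
only used for functions `u` that have one. -/
def weakGradient {n : ℕ} (U : Set (E n)) (u : E n → ℝ) : E n → E n :=
  if h : ∃ G, HasWeakGradient U u G then h.choose else 0

/-- `u ∈ W^{1,p}(U)`. -/
def MemW {n : ℕ} (p : ℝ) (U : Set (E n)) (u : E n → ℝ) : Prop :=
  MemLp u (ENNReal.ofReal p) (volume.restrict U) ∧
    ∃ G, HasWeakGradient U u G ∧ MemLp G (ENNReal.ofReal p) (volume.restrict U)

/-- The `W^{1,p}(U)` norm `‖u‖_{L^p(U)} + ‖∇u‖_{L^p(U)}`. -/
def sobolevNorm {n : ℕ} (p : ℝ) (U : Set (E n)) (u : E n → ℝ) : ℝ≥0∞ :=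
  eLpNorm u (ENNReal.ofReal p) (volume.restrict U) +
    eLpNorm (weakGradient U u) (ENNReal.ofReal p) (volume.restrict U)

/-- For `U ⊆ Ω`: `w` belongs to the closure in `W^{1,p}(U)` of the restrictions to `U` of the
functions in `C¹_c(Ω)`. Only the part of `∂U` on `∂Ω` carries a zero boundary condition. -/
def MemWZeroOn {n : ℕ} (p : ℝ) (Ω U : Set (E n)) (w : E n → ℝ) : Prop :=
  MemW p U w ∧ ∀ ε : ℝ≥0∞, 0 < ε → ∃ φ : E n → ℝ,
    ContDiff ℝ 1 φ ∧ HasCompactSupport φ ∧ tsupport φ ⊆ Ω ∧ sobolevNorm p U (w - φ) < ε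

/-- `w ∈ W₀^{1,p}(Ω)`, the closure of `C¹_c(Ω)` in `W^{1,p}(Ω)`. -/
def MemWZero {n : ℕ} (p : ℝ) (Ω : Set (E n)) (w : E n → ℝ) : Prop :=
  MemWZeroOn p Ω Ω w

/-! ### Boundary data -/

/-- The surface measure `dS` on `∂Ω`: the `(n-1)`-dimensional Hausdorff measure. -/
def surfaceMeasure {n : ℕ} (Ω : Set (E n)) : Measure (E n) :=
  (Measure.hausdorffMeasure ((n : ℝ) - 1)).restrict (frontier Ω)

/-- `g` is the trace on `∂Ω` of `f ∈ W^{1,p}(Ω)`: functions smooth up to the boundary approximate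
`f` in `W^{1,p}(Ω)` and, simultaneously, `g` in `L^p(∂Ω)`. -/
def IsTrace {n : ℕ} (p : ℝ) (Ω : Set (E n)) (f g : E n → ℝ) : Prop :=
  MemLp g (ENNReal.ofReal p) (surfaceMeasure Ω) ∧
    ∀ ε : ℝ≥0∞, 0 < ε → ∃ φ : E n → ℝ, ContDiff ℝ (⊤ : ℕ∞) φ ∧
      sobolevNorm p Ω (f - φ) < ε ∧
      eLpNorm (g - φ) (ENNReal.ofReal p) (surfaceMeasure Ω) < ε

/-- `f` represents an element of `X^p_⋄(∂Ω)`. Elements of the trace space `X^p(∂Ω)` are the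
functions of `W^{1,p}(Ω)` modulo `W₀^{1,p}(Ω)`; those of `X^p_⋄(∂Ω)` have a trace with vanishing
integral over `∂Ω`. -/
def MemXDiamond {n : ℕ} (p : ℝ) (Ω : Set (E n)) (f : E n → ℝ) : Prop :=
  MemW p Ω f ∧ ∃ g, IsTrace p Ω f g ∧ ∫ x, g x ∂(surfaceMeasure Ω) = 0

/-! ### Constitutive assumptions

The conductivity `σ(x, E)` takes values in `[-∞, +∞]`, so that `σ = +∞` (perfect conductor) is
meaningful. -/

/-- Carathéodory function on `S`. The value at `E = 0` is left free: for a growth exponent below `2`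
the conductivity blows up as `E → 0⁺`. -/
def IsCaratheodory {n : ℕ} (S : Set (E n)) (σ : E n → ℝ → EReal) : Prop :=
  (∀ s : ℝ, 0 < s → AEMeasurable (fun x => σ x s) (volume.restrict S)) ∧
    ∀ᵐ x ∂(volume.restrict S), ContinuousOn (σ x) (Ioi 0)

/-- Growth of exponent `r` on `S`. -/
def HasGrowth {n : ℕ} (r : ℝ) (S : Set (E n)) (σ : E n → ℝ → EReal) : Prop :=
  ∃ σlo σhi E₀ : ℝ, 0 < σlo ∧ σlo ≤ σhi ∧ 0 < E₀ ∧
    ∀ᵐ x ∂(volume.restrict S), ∀ s : ℝ, 0 < s →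
      ((σlo * (s / E₀) ^ (r - 2) : ℝ) : EReal) ≤ σ x s ∧
      (2 ≤ r → σ x s ≤ ((σhi * (1 + (s / E₀) ^ (r - 2)) : ℝ) : EReal)) ∧
      (r < 2 → σ x s ≤ ((σhi * (s / E₀) ^ (r - 2) : ℝ) : EReal))

/-- Strong monotonicity, with exponent `r` on `S`, of the vector field `e ↦ σ(x, |e|) e`
(which is `0` at `e = 0`, whatever `σ(x, 0)` is). -/
def IsStronglyMonotone {n : ℕ} (r : ℝ) (S : Set (E n)) (σ : E n → ℝ → EReal) : Prop :=
  ∃ κ : ℝ, 0 < κ ∧ ∀ᵐ x ∂(volume.restrict S), ∀ e₁ e₂ : E n,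
    (2 ≤ r → κ * ‖e₂ - e₁‖ ^ r ≤
      inner ℝ ((σ x ‖e₂‖).toReal • e₂ - (σ x ‖e₁‖).toReal • e₁) (e₂ - e₁)) ∧
    (r < 2 → κ * (1 + ‖e₂‖ ^ 2 + ‖e₁‖ ^ 2) ^ ((r - 2) / 2) * ‖e₂ - e₁‖ ^ 2 ≤
      inner ℝ ((σ x ‖e₂‖).toReal • e₂ - (σ x ‖e₁‖).toReal • e₁) (e₂ - e₁))

/-- `S` is a perfect electric insulator: `σ = 0` there. -/
def IsPEI {n : ℕ} (S : Set (E n)) (σ : E n → ℝ → EReal) : Prop :=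
  ∀ᵐ x ∂(volume.restrict S), ∀ s : ℝ, 0 < s → σ x s = 0

/-- `S` is a perfect electric conductor: `σ = +∞` there. -/
def IsPEC {n : ℕ} (S : Set (E n)) (σ : E n → ℝ → EReal) : Prop :=
  ∀ᵐ x ∂(volume.restrict S), ∀ s : ℝ, 0 < s → σ x s = ⊤

/-! ### Variational problems -/

/-- The Dirichlet energy density `Q(x, s) = ∫₀ˢ σ(x, ξ) ξ dξ ∈ [0, ∞]`. -/
def energyDensity {n : ℕ} (σ : E n → ℝ → EReal) (x : E n) (s : ℝ) : ℝ≥0∞ :=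
  ∫⁻ ξ in Ioc 0 s, (σ x ξ).toENNReal * ENNReal.ofReal ξ

/-- The Dirichlet energy `∫_S Q(x, |G(x)|) dx` in `S` of a potential with gradient `G`. -/
def energyOn {n : ℕ} (σ : E n → ℝ → EReal) (S : Set (E n)) (G : E n → E n) : ℝ≥0∞ :=
  ∫⁻ x in S, energyDensity σ x ‖G x‖

/-- `u` minimizes `J` over the class `adm`, with finite minimum. -/
def IsMinimizer {n : ℕ} (adm : (E n → ℝ) → Prop) (J : (E n → ℝ) → ℝ≥0∞) (u : E n → ℝ) : Prop :=
  adm u ∧ J u < ⊤ ∧ ∀ v, adm v → J u ≤ J v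

/-- Existence and uniqueness (up to equality a.e. in `U`) of a minimizer of `J` over `adm`. -/
def HasUniqueMinimizer {n : ℕ} (U : Set (E n)) (adm : (E n → ℝ) → Prop)
    (J : (E n → ℝ) → ℝ≥0∞) : Prop :=
  ∃ u, IsMinimizer adm J u ∧ ∀ v, IsMinimizer adm J v → v =ᵐ[volume.restrict U] u

/-- Competitors for the two-phase problem: `u ∈ W^{1,p}(Ω) ∪ W^{1,q}(Ω)` with `u = f` on `∂Ω`,
i.e. `u - f ∈ W₀^{1,p}(Ω) ∪ W₀^{1,q}(Ω)`. -/
def AdmissibleTwoPhase {n : ℕ} (p q : ℝ) (Ω : Set (E n)) (f u : E n → ℝ) : Prop :=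
  (MemW p Ω u ∨ MemW q Ω u) ∧ (MemWZero p Ω (u - f) ∨ MemWZero q Ω (u - f))

/-- The Dirichlet energy of the two-phase problem, `∫_B Q_B(x, |∇u|) dx + ∫_A Q_A(x, |∇u|) dx`. -/
def energyTwoPhase {n : ℕ} (Ω A : Set (E n)) (σ : E n → ℝ → EReal) (u : E n → ℝ) : ℝ≥0∞ :=
  energyOn σ (outerPhase Ω A) (weakGradient Ω u) + energyOn σ A (weakGradient Ω u)

/-- Competitors when `A` is a perfect insulator: `u ∈ W^{1,p}(B)` with `u = f` on `∂Ω` (and no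
condition on `∂A`). -/
def AdmissiblePEI {n : ℕ} (p : ℝ) (Ω A : Set (E n)) (f u : E n → ℝ) : Prop :=
  MemW p (outerPhase Ω A) u ∧ MemWZeroOn p Ω (outerPhase Ω A) (u - f)

/-- The Dirichlet energy `∫_B Q_B(x, |∇u|) dx` of `u ∈ W^{1,p}(B)`. -/
def energyPEI {n : ℕ} (Ω A : Set (E n)) (σ : E n → ℝ → EReal) (u : E n → ℝ) : ℝ≥0∞ :=
  energyOn σ (outerPhase Ω A) (weakGradient (outerPhase Ω A) u)

/-- Competitors when `A` is a perfect conductor: `u ∈ W^{1,p}(Ω)` with `u = f` on `∂Ω` and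
`|∇u| = 0` a.e. in `A`. -/
def AdmissiblePEC {n : ℕ} (p : ℝ) (Ω A : Set (E n)) (f u : E n → ℝ) : Prop :=
  MemW p Ω u ∧ MemWZero p Ω (u - f) ∧ ∀ᵐ x ∂(volume.restrict A), ‖weakGradient Ω u x‖ = 0

/-- The Dirichlet energy `∫_B Q_B(x, |∇u|) dx` of `u ∈ W^{1,p}(Ω)`. -/
def energyPEC {n : ℕ} (Ω A : Set (E n)) (σ : E n → ℝ → EReal) (u : E n → ℝ) : ℝ≥0∞ :=
  energyOn σ (outerPhase Ω A) (weakGradient Ω u)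

end TwoPhase

end

/-! All four problems are instances of one: minimize a uniformly convex energy on a set `S ⊆ U`
among functions of W^{1,r}(U) with prescribed values on ∂Ω and zero gradient on `Z`, where `S ∪ Z`
fills `U` up to a null set. Weak compactness is not needed, because uniform convexity makes every
minimizing sequence strongly Cauchy.

Convexity. Integrating the strong monotonicity of e ↦ σ(x,|e|)e along two opposite segments issuing
from a midpoint bounds the midpoint convexity gap of Q from below: by |e₁ - e₂|^p if p ≥ 2, by a
weighted square if p < 2. Interpolation and coercivity turn this into |e₁ - e₂|^r ≤ ε(1 + Q(e₁) +
Q(e₂)) + C · gap for every ε > 0 and 0 < r ≤ p (`exists_uniform_convexity`,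
`isUniformlyConvexEnergy`). Allowing r < p matters: two phases of exponents p and q are both handled
with r = min p q, and on a bounded domain the union of the two Sobolev spaces is W^{1,r}.

Direct method. The midpoint of two competitors is a competitor, so its energy is at least the
infimum. Hence two almost minimizers have a small integrated gap, and their gradients are close in
L^r (`IsUniformlyConvexEnergy.lintegral_le`). A Poincaré inequality makes the functions close as
well. Completeness provides a limit, Fatou's lemma shows that it is minimal, and the same estimate
gives uniqueness (`hasUniqueMinimizer_of_isUniformlyConvexEnergy`).

Poincaré inequality. For an insulator it is needed on B, for functions that vanish only near ∂Ω. It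
is proved by chaining: control of the L^p norm passes from a set `T` of positive measure to a set
`S` when all segments from `S` to `T` avoid the closure of A. The chain starts at balls outside Ω,
where the functions vanish, spreads through B by connectedness, and reaches ∂A because near a
Lipschitz boundary point the exterior is star-shaped with respect to a small ball. Compactness of
the closure of B leaves finitely many pieces (`IsTwoPhaseDomain.isControlled`).

Finiteness. For a conductor and for two phases, (1 - χ)f with χ a cutoff equal to 1 on the closure
of A is a competitor of finite energy: it vanishes in A, so neither the constraint there nor an
exponent q > p causes trouble (`exists_extension`). For an insulator, f itself serves. -/

namespace TwoPhase

/-! ### Uniform convexity of radial potentials. -/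

section Radial

variable {n : ℕ}

/-- The derivative along a line of a radial potential `e ↦ ∫₀^|e| b`, `b ξ = s ξ * ξ`. -/
theorem hasDerivAt_radialPotential {b s : ℝ → ℝ} (hb : Continuous b) (hb0 : b 0 = 0)
    (hbs : ∀ ξ, 0 < ξ → b ξ = s ξ * ξ) (m d : E n) (t : ℝ) :
    HasDerivAt (fun t : ℝ => ∫ ξ in (0 : ℝ)..‖m + t • d‖, b ξ)
      (inner ℝ (s ‖m + t • d‖ • (m + t • d)) d) t := by
  have hQ : ∀ y : ℝ, HasDerivAt (fun y => ∫ ξ in (0 : ℝ)..y, b ξ) (b y) y := fun y =>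
    (hb.integral_hasStrictDerivAt 0 y).hasDerivAt
  have hline : HasDerivAt (fun t : ℝ => m + t • d) d t := by
    simpa using ((hasDerivAt_id t).smul_const d).const_add m
  -- The norm is not differentiable at the origin, but `b 0 = 0` makes the primitive of `b` an o(y)
  -- there, so its composition with the norm has derivative zero.
  by_cases h0 : m + t • d = 0
  · have hF : HasFDerivAt (fun e : E n => ∫ ξ in (0 : ℝ)..‖e‖, b ξ) (0 : E n →L[ℝ] ℝ)
        (m + t • d) := by
      rw [h0, hasFDerivAt_iff_isLittleO_nhds_zero]
      have h1 := (hasDerivAt_iff_isLittleO_nhds_zero.1 (hQ 0))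
      simp only [zero_add, intervalIntegral.integral_same, sub_zero, hb0, smul_zero] at h1
      have h2 := (h1.comp_tendsto (tendsto_norm_zero (E := E n))).of_norm_right
      simpa [Function.comp_def] using h2
    have := hF.comp_hasDerivAt t hline
    simpa [h0, Function.comp_def] using this
  · have hpos : 0 < ‖m + t • d‖ := norm_pos_iff.2 h0
    have h1 := hline.norm_sq.sqrt (by positivity)
    have h2 : HasDerivAt (fun t : ℝ => ‖m + t • d‖) (inner ℝ (m + t • d) d / ‖m + t • d‖) t := by
      simp only [Real.sqrt_sq (norm_nonneg _)] at h1
      convert h1 using 1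
      field_simp
    refine ((hQ ‖m + t • d‖).comp t h2).congr_deriv ?_
    rw [hbs _ hpos, inner_smul_left]
    simp only [conj_trivial]
    field_simp

/-- The bound `c * t ^ (k - 1)` integrates to `c / k`. The integration is replaced by the
monotonicity of a difference, so that no integrability of `g'` is required. -/
theorem le_sub_of_deriv_growth {g g' : ℝ → ℝ} (hg : ∀ t, HasDerivAt g (g' t) t) {c k : ℝ}
    (hk : 1 < k) (h : ∀ t ∈ Ioo (0 : ℝ) 1, c * t ^ (k - 1) ≤ g' t - g' 0) :
    c / k ≤ g 1 - g 0 - g' 0 := by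
  have hder : ∀ t : ℝ, HasDerivAt (fun t => g t - g' 0 * t - c / k * t ^ k)
      (g' t - g' 0 - c * t ^ (k - 1)) t := fun t => by
    have h1 := (Real.hasDerivAt_rpow_const (x := t) (p := k) (Or.inr hk.le)).const_mul (c / k)
    have h2 := (hasDerivAt_id t).const_mul (g' 0)
    refine (((hg t).sub h2).sub h1).congr_deriv ?_
    have hk0 : k ≠ 0 := by linarith
    field_simp
  have hmono : MonotoneOn (fun t => g t - g' 0 * t - c / k * t ^ k) (Icc 0 1) := by
    refine monotoneOn_of_deriv_nonneg (convex_Icc 0 1)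
      (fun t _ => (hder t).continuousAt.continuousWithinAt)
      (fun t _ => (hder t).differentiableAt.differentiableWithinAt) fun t ht => ?_
    rw [interior_Icc] at ht
    rw [(hder t).deriv]
    linarith [h t ht]
  have := hmono (left_mem_Icc.2 zero_le_one) (right_mem_Icc.2 zero_le_one) zero_le_one
  simp only [mul_zero, sub_zero, mul_one, Real.one_rpow, Real.zero_rpow (by linarith : k ≠ 0)] at this
  linarith

/-- Expand the potential at `m` in the directions `d` and `-d`: the first-order terms are opposite
and disappear in the average. -/
theorem radialPotential_midpoint_gap {b s : ℝ → ℝ} (hb : Continuous b) (hb0 : b 0 = 0)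
    (hbs : ∀ ξ, 0 < ξ → b ξ = s ξ * ξ) {c k : ℝ} (hk : 1 < k) (m d : E n)
    (h : ∀ t ∈ Ioo (0 : ℝ) 1, ∀ d' : E n, d' = d ∨ d' = -d → c * t ^ (k - 1) ≤
      inner ℝ (s ‖m + t • d'‖ • (m + t • d') - s ‖m‖ • m) d') :
    (∫ ξ in (0 : ℝ)..‖m‖, b ξ) + c / k ≤
      ((∫ ξ in (0 : ℝ)..‖m + d‖, b ξ) + ∫ ξ in (0 : ℝ)..‖m - d‖, b ξ) / 2 := by
  have key : ∀ d' : E n, d' = d ∨ d' = -d → c / k ≤ (∫ ξ in (0 : ℝ)..‖m + d'‖, b ξ) -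
      (∫ ξ in (0 : ℝ)..‖m‖, b ξ) - inner ℝ (s ‖m‖ • m) d' := fun d' hd' => by
    have := le_sub_of_deriv_growth (c := c)
      (fun t => hasDerivAt_radialPotential hb hb0 hbs m d' t) hk fun t ht => by
        simpa [inner_sub_left] using h t ht d' hd'
    simpa using this
  have h1 := key d (Or.inl rfl)
  have h2 := key (-d) (Or.inr rfl)
  rw [inner_neg_right, ← sub_eq_add_neg] at h2
  linarith

/-- The lower bound in the strong monotonicity of the field `e ↦ s(|e|) e`, at a point. -/
def StrongMonotoneField (r κ : ℝ) (a : E n → E n) : Prop :=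
  ∀ e₁ e₂ : E n,
    (2 ≤ r → κ * ‖e₂ - e₁‖ ^ r ≤ inner ℝ (a e₂ - a e₁) (e₂ - e₁)) ∧
    (r < 2 → κ * (1 + ‖e₂‖ ^ 2 + ‖e₁‖ ^ 2) ^ ((r - 2) / 2) * ‖e₂ - e₁‖ ^ 2 ≤
      inner ℝ (a e₂ - a e₁) (e₂ - e₁))

/-- Monotonicity between `m` and `m ± t • d` bounds `t` times the derivative increment by κ(t‖d‖)^r;
dividing by `t` leaves the growth `t ^ (r - 1)`. -/
theorem gap_of_two_le {b s : ℝ → ℝ} (hb : Continuous b) (hb0 : b 0 = 0)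
    (hbs : ∀ ξ, 0 < ξ → b ξ = s ξ * ξ) {r κ : ℝ} (hr : 2 ≤ r)
    (hs : StrongMonotoneField r κ fun e : E n => s ‖e‖ • e) (m d : E n) :
    (∫ ξ in (0 : ℝ)..‖m‖, b ξ) + κ * ‖d‖ ^ r / r ≤
      ((∫ ξ in (0 : ℝ)..‖m + d‖, b ξ) + ∫ ξ in (0 : ℝ)..‖m - d‖, b ξ) / 2 := by
  refine radialPotential_midpoint_gap hb hb0 hbs (by linarith) m d fun t ht d' hd' => ?_
  have hnd : ‖d'‖ = ‖d‖ := by rcases hd' with rfl | rfl <;> simp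
  have h := (hs m (m + t • d')).1 hr
  have ht0 : 0 < t := ht.1
  simp only [add_sub_cancel_left, norm_smul, Real.norm_eq_abs, abs_of_pos ht0, hnd,
    inner_smul_right] at h
  rw [Real.mul_rpow ht0.le (norm_nonneg _)] at h
  have h3 : t ^ r = t * t ^ (r - 1) := by
    rw [← Real.rpow_one_add' ht0.le (by linarith)]; congr 1; ring
  rw [h3] at h
  refine le_of_mul_le_mul_left ?_ ht0
  linarith

/-- The weight depends on the intermediate point `m ± t • d`. Since its exponent is negative, it
suffices to bound its base from above uniformly in `t`; the parallelogram law does this by twice the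
base at the endpoints. -/
theorem gap_of_lt_two {b s : ℝ → ℝ} (hb : Continuous b) (hb0 : b 0 = 0)
    (hbs : ∀ ξ, 0 < ξ → b ξ = s ξ * ξ) {r κ : ℝ} (hκ : 0 < κ) (hr : r < 2)
    (hs : StrongMonotoneField r κ fun e : E n => s ‖e‖ • e) (m d : E n) :
    (∫ ξ in (0 : ℝ)..‖m‖, b ξ) +
        κ * (2 * (1 + ‖m + d‖ ^ 2 + ‖m - d‖ ^ 2)) ^ ((r - 2) / 2) * ‖d‖ ^ 2 / 2 ≤
      ((∫ ξ in (0 : ℝ)..‖m + d‖, b ξ) + ∫ ξ in (0 : ℝ)..‖m - d‖, b ξ) / 2 := by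
  refine radialPotential_midpoint_gap hb hb0 hbs one_lt_two m d fun t ht d' hd' => ?_
  have hpar := parallelogram_law_with_norm ℝ m d
  have hnd : ‖d'‖ = ‖d‖ := by rcases hd' with rfl | rfl <;> simp
  have h := (hs m (m + t • d')).2 hr
  have ht0 : 0 < t := ht.1
  have ht1 : t < 1 := ht.2
  have hle : ‖m + t • d'‖ ≤ ‖m‖ + ‖d‖ := by
    refine (norm_add_le _ _).trans ?_
    rw [norm_smul, hnd, Real.norm_eq_abs, abs_of_pos ht0]
    nlinarith [norm_nonneg d]
  have hM : 1 + ‖m + t • d'‖ ^ 2 + ‖m‖ ^ 2 ≤ 2 * (1 + ‖m + d‖ ^ 2 + ‖m - d‖ ^ 2) := by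
    have h1 : ‖m + t • d'‖ ^ 2 ≤ (‖m‖ + ‖d‖) ^ 2 := by gcongr
    nlinarith [sq_nonneg (‖m‖ - ‖d‖), sq_nonneg ‖d‖]
  have hpow := Real.rpow_le_rpow_of_nonpos (by positivity) hM (by linarith : (r - 2) / 2 ≤ 0)
  simp only [add_sub_cancel_left, norm_smul, Real.norm_eq_abs, abs_of_pos ht0, hnd,
    inner_smul_right] at h
  have h4 : (2 : ℝ) - 1 = 1 := by norm_num
  rw [h4, Real.rpow_one]
  refine le_of_mul_le_mul_left ?_ ht0
  refine le_trans ?_ h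
  have h5 := mul_le_mul_of_nonneg_left hpow (by positivity : 0 ≤ κ * (t * ‖d‖) ^ 2)
  nlinarith

/-- Either `x ^ r` is at most `ε`, or `x` is bounded below and the factor `x ^ (r - p)` is at most
`ε ^ ((r - p) / r)`. -/
theorem rpow_le_add_mul_rpow {ε r p : ℝ} (hε : 0 < ε) (hr : 0 < r) (hrp : r ≤ p) {x : ℝ}
    (hx : 0 ≤ x) : x ^ r ≤ ε + ε ^ ((r - p) / r) * x ^ p := by
  by_cases h : x ^ r ≤ ε
  · have : 0 ≤ ε ^ ((r - p) / r) * x ^ p := by positivity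
    linarith
  · push Not at h
    have hx0 : 0 < x := by
      rcases hx.eq_or_lt with rfl | hx
      · rw [Real.zero_rpow hr.ne'] at h; linarith
      · exact hx
    have h1 : (x ^ r) ^ ((r - p) / r) ≤ ε ^ ((r - p) / r) :=
      Real.rpow_le_rpow_of_nonpos hε h.le (div_nonpos_of_nonpos_of_nonneg (by linarith) hr.le)
    rw [← Real.rpow_mul hx, mul_div_cancel₀ _ hr.ne'] at h1
    have h2 : x ^ r = x ^ (r - p) * x ^ p := by rw [← Real.rpow_add hx0]; congr 1; ring
    rw [h2]
    have := mul_le_mul_of_nonneg_right h1 (Real.rpow_nonneg hx p)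
    linarith

/-- Subadditivity of the concave power z ↦ z^{p/2}, used twice. -/
theorem one_add_sq_rpow_le {p x y : ℝ} (hp : 0 < p) (hp2 : p ≤ 2) (hx : 0 ≤ x) (hy : 0 ≤ y) :
    (1 + x ^ 2 + y ^ 2) ^ (p / 2) ≤ 1 + x ^ p + y ^ p := by
  have h : ∀ z : ℝ, 0 ≤ z → (z ^ 2) ^ (p / 2) = z ^ p := fun z hz => by
    rw [← Real.rpow_natCast, ← Real.rpow_mul hz]; congr 1; push_cast; ring
  have h1 := Real.rpow_add_le_add_rpow (by positivity : 0 ≤ 1 + x ^ 2) (by positivity : 0 ≤ y ^ 2)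
    (by positivity : 0 ≤ p / 2) (by linarith)
  have h2 := Real.rpow_add_le_add_rpow zero_le_one (by positivity : 0 ≤ x ^ 2)
    (by positivity : 0 ≤ p / 2) (by linarith)
  rw [h y hy] at h1
  rw [h x hx, Real.one_rpow] at h2
  linarith

/-- Quantitative uniform convexity: the constant depends on the exponents, on `κ` and on `ε`. -/
theorem exists_uniform_convexity {r p κ ε : ℝ} (hr : 0 < r) (hrp : r ≤ p) (hp : 1 < p)
    (hκ : 0 < κ) (hε : 0 < ε) :
    ∃ K : ℝ, 0 < K ∧ ∀ b s : ℝ → ℝ, Continuous b → b 0 = 0 → (∀ ξ, 0 < ξ → b ξ = s ξ * ξ) →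
      StrongMonotoneField p κ (fun e : E n => s ‖e‖ • e) → ∀ e₁ e₂ : E n,
      ‖e₁ - e₂‖ ^ r ≤ ε * (1 + ‖e₁‖ ^ p + ‖e₂‖ ^ p) +
        K * (((∫ ξ in (0 : ℝ)..‖e₁‖, b ξ) + ∫ ξ in (0 : ℝ)..‖e₂‖, b ξ) / 2 -
          ∫ ξ in (0 : ℝ)..‖(2⁻¹ : ℝ) • (e₁ + e₂)‖, b ξ) := by
  have hmd : ∀ e₁ e₂ : E n, (2⁻¹ : ℝ) • (e₁ + e₂) + (2⁻¹ : ℝ) • (e₁ - e₂) = e₁ ∧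
      (2⁻¹ : ℝ) • (e₁ + e₂) - (2⁻¹ : ℝ) • (e₁ - e₂) = e₂ := fun e₁ e₂ => by
    constructor <;> module
  -- the case `r = p`
  have main : ∀ δ : ℝ, 0 < δ → ∃ K : ℝ, 0 < K ∧ ∀ b s : ℝ → ℝ, Continuous b → b 0 = 0 →
      (∀ ξ, 0 < ξ → b ξ = s ξ * ξ) →
      StrongMonotoneField p κ (fun e : E n => s ‖e‖ • e) → ∀ e₁ e₂ : E n,
      ‖e₁ - e₂‖ ^ p ≤ δ * (1 + ‖e₁‖ ^ p + ‖e₂‖ ^ p) +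
        K * (((∫ ξ in (0 : ℝ)..‖e₁‖, b ξ) + ∫ ξ in (0 : ℝ)..‖e₂‖, b ξ) / 2 -
          ∫ ξ in (0 : ℝ)..‖(2⁻¹ : ℝ) • (e₁ + e₂)‖, b ξ) := by
    intro δ hδ
    rcases le_or_gt 2 p with h2 | h2
    · refine ⟨p * 2 ^ p / κ, by positivity, fun b s hb hb0 hbs hs e₁ e₂ => ?_⟩
      have h := gap_of_two_le hb hb0 hbs h2 hs ((2⁻¹ : ℝ) • (e₁ + e₂)) ((2⁻¹ : ℝ) • (e₁ - e₂))
      rw [(hmd e₁ e₂).1, (hmd e₁ e₂).2] at h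
      have h3 : ‖(2⁻¹ : ℝ) • (e₁ - e₂)‖ ^ p = ‖e₁ - e₂‖ ^ p / 2 ^ p := by
        rw [norm_smul, Real.mul_rpow (by positivity) (by positivity), Real.norm_eq_abs,
          abs_of_pos (by norm_num), Real.inv_rpow (by norm_num)]
        field_simp
      rw [h3] at h
      have h4 : ‖e₁ - e₂‖ ^ p = p * 2 ^ p / κ * (κ * (‖e₁ - e₂‖ ^ p / 2 ^ p) / p) := by
        have : (2 : ℝ) ^ p ≠ 0 := by positivity
        field_simp
      rw [h4]
      have h5 : 0 ≤ δ * (1 + ‖e₁‖ ^ p + ‖e₂‖ ^ p) := by positivity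
      refine le_trans ?_ (le_add_of_nonneg_left h5)
      gcongr
      linarith
    -- The 8 combines the factor 1/2 of the gap estimate with ‖d‖² = ‖e₁ - e₂‖²/4 for the half
    -- difference `d`; the power of 2 comes from the doubled base of the weight.
    · set c₀ : ℝ := κ * 2 ^ ((p - 2) / 2) / 8 with hc₀
      have hc : 0 < c₀ := by positivity
      refine ⟨δ ^ ((p - 2) / p) / c₀, by positivity, fun b s hb hb0 hbs hs e₁ e₂ => ?_⟩
      have h := gap_of_lt_two hb hb0 hbs hκ h2 hs ((2⁻¹ : ℝ) • (e₁ + e₂))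
        ((2⁻¹ : ℝ) • (e₁ - e₂))
      rw [(hmd e₁ e₂).1, (hmd e₁ e₂).2] at h
      set M : ℝ := 1 + ‖e₁‖ ^ 2 + ‖e₂‖ ^ 2 with hM
      have hMpos : 0 < M := by positivity
      set G := ((∫ ξ in (0 : ℝ)..‖e₁‖, b ξ) + ∫ ξ in (0 : ℝ)..‖e₂‖, b ξ) / 2 -
          ∫ ξ in (0 : ℝ)..‖(2⁻¹ : ℝ) • (e₁ + e₂)‖, b ξ with hG
      have h3 : c₀ * (M ^ ((p - 2) / 2) * ‖e₁ - e₂‖ ^ 2) ≤ G := by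
        have hns : ‖(2⁻¹ : ℝ) • (e₁ - e₂)‖ ^ 2 = ‖e₁ - e₂‖ ^ 2 / 4 := by
          rw [norm_smul, Real.norm_eq_abs, abs_of_pos (by norm_num : (0 : ℝ) < 2⁻¹)]; ring
        rw [Real.mul_rpow (by norm_num) hMpos.le, hns] at h
        rw [hG, hc₀]
        linarith
      -- Interpolate between the exponents `p` and 2 for the quotient ‖e₁ - e₂‖ / √M, then multiply
      -- by `M ^ (p / 2)`.
      have h4 : ‖e₁ - e₂‖ ^ p ≤ δ * M ^ (p / 2) +
          δ ^ ((p - 2) / p) * (M ^ ((p - 2) / 2) * ‖e₁ - e₂‖ ^ 2) := by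
        have h5 := rpow_le_add_mul_rpow hδ (by linarith : 0 < p) h2.le
          (div_nonneg (norm_nonneg (e₁ - e₂)) (Real.rpow_nonneg hMpos.le (1 / 2)))
        have h6 : (M ^ (1 / 2 : ℝ)) ^ p = M ^ (p / 2) := by
          rw [← Real.rpow_mul hMpos.le]; congr 1; ring
        rw [Real.div_rpow (norm_nonneg _) (by positivity),
          Real.div_rpow (norm_nonneg _) (by positivity), h6, div_le_iff₀ (by positivity)] at h5
        refine h5.trans (le_of_eq ?_)
        have h7 : (M ^ (1 / 2 : ℝ)) ^ (2 : ℝ) = M := by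
          rw [← Real.rpow_mul hMpos.le]; norm_num
        have h8 : M ^ (p / 2) = M ^ ((p - 2) / 2) * M := by
          rw [← Real.rpow_add_one hMpos.ne']; congr 1; ring
        rw [h7, Real.rpow_two]
        nth_rewrite 1 [add_mul]
        nth_rewrite 2 [h8]
        field_simp
      have h9 : M ^ (p / 2) ≤ 1 + ‖e₁‖ ^ p + ‖e₂‖ ^ p :=
        one_add_sq_rpow_le (by linarith) h2.le (norm_nonneg _) (norm_nonneg _)
      refine h4.trans (add_le_add (by gcongr) ?_)
      rw [div_mul_eq_mul_div, le_div_iff₀ hc, mul_assoc]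
      refine mul_le_mul_of_nonneg_left ?_ (by positivity)
      linarith
  -- Passing from exponent `r` to `p` costs an additive ε/2 and the factor (ε/2)^((r-p)/r). The
  -- parameter given to `main` is divided by this factor, so that its error also becomes ε/2.
  obtain ⟨K, hK, h⟩ := main (ε / 2 / (ε / 2) ^ ((r - p) / r)) (by positivity)
  refine ⟨(ε / 2) ^ ((r - p) / r) * K, by positivity, fun b s hb hb0 hbs hs e₁ e₂ => ?_⟩
  have h1 := rpow_le_add_mul_rpow (half_pos hε) hr hrp (norm_nonneg (e₁ - e₂))
  have h2 := mul_le_mul_of_nonneg_left (h b s hb hb0 hbs hs e₁ e₂)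
    (by positivity : 0 ≤ (ε / 2) ^ ((r - p) / r))
  have h3 : (ε / 2) ^ ((r - p) / r) ≠ 0 := by positivity
  rw [mul_add, ← mul_assoc, mul_div_cancel₀ _ h3] at h2
  have h4 : 0 ≤ ‖e₁‖ ^ p := by positivity
  have h5 : 0 ≤ ‖e₂‖ ^ p := by positivity
  nlinarith

end Radial

/-! ### Measurability, growth and uniform convexity of the energy density. -/

section EnergyDensity

variable {n : ℕ}

/-- Joint measurability of a Carathéodory function. Off one null set the function is continuous in
`t` and agrees at all rational `t` with measurable representatives; values at real `t` are limits of
these. On the null set it is replaced by 0. -/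
theorem exists_measurable_uncurry_of_ae_continuous {α : Type*} [MeasurableSpace α] {μ : Measure α}
    {F : ℝ → α → ℝ≥0∞} (hm : ∀ t, AEMeasurable (F t) μ)
    (hc : ∀ᵐ x ∂μ, Continuous fun t => F t x) :
    ∃ F' : ℝ → α → ℝ≥0∞, Measurable (Function.uncurry F') ∧ ∀ᵐ x ∂μ, ∀ t, F' t x = F t x := by
  have hmk : ∀ᵐ x ∂μ, ∀ q : ℚ, F q x = (hm q).mk (F q) x := ae_all_iff.2 fun q => (hm q).ae_eq_mk
  obtain ⟨N, hN, hNm, hN0⟩ := exists_measurable_superset_of_null (ae_iff.1 (hc.and hmk))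
  have hgood : ∀ x, x ∉ N → (Continuous fun t => F t x) ∧ ∀ q : ℚ, F q x = (hm q).mk (F q) x :=
    fun x hx => by
      by_contra h
      exact hx (hN h)
  refine ⟨fun t => Nᶜ.indicator (F t), ?_, ?_⟩
  · have hcont : ∀ x, Continuous fun t => Nᶜ.indicator (F t) x := fun x => by
      by_cases hx : x ∈ N
      · simpa [hx] using continuous_const
      · simpa [hx] using (hgood x hx).1
    have hq : ∀ q : ℚ, Measurable (Nᶜ.indicator (F q)) := fun q => by
      have h : Nᶜ.indicator (F q) = Nᶜ.indicator ((hm q).mk (F q)) := by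
        ext x
        by_cases hx : x ∈ N
        · simp [hx]
        · simp [hx, (hgood x hx).2 q]
      rw [h]
      exact (hm q).measurable_mk.indicator hNm.compl
    refine measurable_uncurry_of_continuous_of_measurable hcont fun t => ?_
    obtain ⟨u, -, -, hu⟩ := Real.exists_seq_rat_strictMono_tendsto t
    refine measurable_of_tendsto_metrizable (fun k => hq (u k)) (tendsto_pi_nhds.2 fun x => ?_)
    exact ((hcont x).tendsto t).comp hu
  · have : ∀ᵐ x ∂μ, x ∉ N := by rw [ae_iff]; simpa using hN0
    filter_upwards [this] with x hx t
    simp [hx]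

/-- The substitution ξ = exp t turns continuity on (0, ∞) into continuity on ℝ, which yields a
jointly measurable version of σ. The energy density is then an integral over ξ > 0 of a jointly
measurable function cut off at ξ ≤ g x, and Tonelli's theorem applies. -/
theorem aemeasurable_energyDensity {S : Set (E n)} {σ : E n → ℝ → EReal}
    (hσ : IsCaratheodory S σ) {g : E n → ℝ} (hg : AEMeasurable g (volume.restrict S)) :
    AEMeasurable (fun x => energyDensity σ x (g x)) (volume.restrict S) := by
  obtain ⟨F, hFm, hF⟩ := exists_measurable_uncurry_of_ae_continuous (μ := volume.restrict S)
    (F := fun t x => (σ x (Real.exp t)).toENNReal)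
    (fun t => (hσ.1 _ (Real.exp_pos t)).ereal_toENNReal) (by
      filter_upwards [hσ.2] with x hx
      exact (hx.ereal_toENNReal).comp_continuous Real.continuous_exp fun t => Real.exp_pos t)
  have hjoint : Measurable fun z : E n × ℝ => {z : E n × ℝ | z.2 ≤ hg.mk g z.1}.indicator
      (fun z => F (Real.log z.2) z.1 * ENNReal.ofReal z.2) z := by
    refine Measurable.indicator ?_ (measurableSet_le measurable_snd
      (hg.measurable_mk.comp measurable_fst))
    refine Measurable.mul ?_ (ENNReal.measurable_ofReal.comp measurable_snd)
    exact hFm.comp ((Real.measurable_log.comp measurable_snd).prodMk measurable_fst)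
  refine ⟨_, hjoint.lintegral_prod_right' (ν := volume.restrict (Ioi 0)), ?_⟩
  filter_upwards [hF, hg.ae_eq_mk] with x hx hgx
  rw [energyDensity, hgx, show Ioc 0 (hg.mk g x) = Iic (hg.mk g x) ∩ Ioi 0 by ext; simp [and_comm],
    ← Measure.restrict_restrict measurableSet_Iic, ← lintegral_indicator measurableSet_Iic]
  refine setLIntegral_congr_fun measurableSet_Ioi fun ξ hξ => ?_
  by_cases h : ξ ≤ hg.mk g x
  · simp [h, hx, Real.exp_log hξ]
  · simp [h]

/-- `b ξ = σ(x, ξ) ξ` for `ξ > 0`, extended by `0`, with growth bounds of exponent `r - 1`. -/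
structure IsFlux (r lo hi : ℝ) (σ : E n → ℝ → EReal) (x : E n) (b : ℝ → ℝ) : Prop where
  continuous : Continuous b
  eq_zero : ∀ ξ ≤ 0, b ξ = 0
  eq_mul : ∀ ξ, 0 < ξ → b ξ = (σ x ξ).toReal * ξ
  lower : ∀ ξ, 0 < ξ → lo * ξ ^ (r - 1) ≤ b ξ
  upper : ∀ ξ, 0 < ξ → b ξ ≤ hi * (1 + ξ ^ (r - 1))
  energyDensity_eq : ∀ s, 0 ≤ s → energyDensity σ x s = ENNReal.ofReal (∫ ξ in (0 : ℝ)..s, b ξ)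

/-- The growth bounds make σ finite and positive for ξ > 0, so σ(x, ξ)ξ is a real function. It is at
most a constant times ξ + ξ^(r-1), which tends to 0 at 0 because r > 1: extension by 0 is continuous
even where σ itself blows up. -/
theorem exists_isFlux {r : ℝ} (hr : 1 < r) {S : Set (E n)} {σ : E n → ℝ → EReal}
    (hc : IsCaratheodory S σ) (hg : HasGrowth r S σ) :
    ∃ lo hi : ℝ, 0 < lo ∧ 0 < hi ∧ ∀ᵐ x ∂(volume.restrict S), ∃ b, IsFlux r lo hi σ x b := by
  obtain ⟨σlo, σhi, E₀, hlo, hlohi, hE, hb⟩ := hg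
  have hhi : 0 < σhi := hlo.trans_le hlohi
  set B : ℝ := E₀ ^ (2 - r) with hBdef
  have hB : 0 < B := by positivity
  have hpow : ∀ ξ : ℝ, 0 < ξ → (ξ / E₀) ^ (r - 2) * ξ = B * ξ ^ (r - 1) := fun ξ hξ => by
    rw [Real.div_rpow hξ.le hE.le, show r - 1 = r - 2 + 1 by ring, Real.rpow_add_one hξ.ne',
      hBdef, show 2 - r = -(r - 2) by ring, Real.rpow_neg hE.le]
    field_simp
  refine ⟨σlo * B, σhi * (1 + B), by positivity, by positivity, ?_⟩
  filter_upwards [hc.2, hb] with x hxc hx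
  have hup : ∀ s : ℝ, 0 < s → σ x s ≤ ((σhi * (1 + (s / E₀) ^ (r - 2)) : ℝ) : EReal) :=
    fun s hs => by
      rcases le_or_gt 2 r with h | h
      · exact (hx s hs).2.1 h
      · refine ((hx s hs).2.2 h).trans (EReal.coe_le_coe_iff.2 ?_)
        gcongr
        linarith
  have htop : ∀ s : ℝ, 0 < s → σ x s ≠ ⊤ := fun s hs h => by
    have := hup s hs
    rw [h, top_le_iff] at this
    exact EReal.coe_ne_top _ this
  have hbot : ∀ s : ℝ, 0 < s → σ x s ≠ ⊥ := fun s hs h => by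
    have := (hx s hs).1
    rw [h, le_bot_iff] at this
    exact EReal.coe_ne_bot _ this
  have hcoe : ∀ s : ℝ, 0 < s → ((σ x s).toReal : EReal) = σ x s := fun s hs =>
    EReal.coe_toReal (htop s hs) (hbot s hs)
  set b : ℝ → ℝ := fun ξ => if 0 < ξ then (σ x ξ).toReal * ξ else 0 with hbdef
  have hbpos : ∀ ξ, 0 < ξ → b ξ = (σ x ξ).toReal * ξ := fun ξ hξ => by simp [hbdef, hξ]
  have hbneg : ∀ ξ ≤ 0, b ξ = 0 := fun ξ hξ => by simp [hbdef, not_lt.2 hξ]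
  have hlow : ∀ ξ, 0 < ξ → σlo * B * ξ ^ (r - 1) ≤ b ξ := fun ξ hξ => by
    have h := (hx ξ hξ).1
    rw [← hcoe ξ hξ, EReal.coe_le_coe_iff] at h
    rw [hbpos ξ hξ, mul_assoc, ← hpow ξ hξ, ← mul_assoc]
    gcongr
  have hupp : ∀ ξ, 0 < ξ → b ξ ≤ σhi * (ξ + B * ξ ^ (r - 1)) := fun ξ hξ => by
    have h := hup ξ hξ
    rw [← hcoe ξ hξ, EReal.coe_le_coe_iff] at h
    rw [hbpos ξ hξ, ← hpow ξ hξ]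
    refine (mul_le_mul_of_nonneg_right h hξ.le).trans (le_of_eq ?_)
    ring
  have hbnn : ∀ ξ, 0 ≤ b ξ := fun ξ => by
    rcases le_or_gt ξ 0 with h | h
    · rw [hbneg ξ h]
    · exact le_trans (by positivity) (hlow ξ h)
  have hcont : Continuous b := by
    rw [continuous_iff_continuousAt]
    intro ξ
    rcases lt_trichotomy ξ 0 with h | h | h
    · refine (continuousAt_const (y := (0 : ℝ))).congr ?_
      filter_upwards [Iio_mem_nhds h] with y hy
      exact (hbneg y (le_of_lt hy)).symm
    · subst h
      have hlim : Tendsto (fun ξ : ℝ => σhi * (|ξ| + B * |ξ| ^ (r - 1))) (𝓝 0) (𝓝 0) := by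
        have : Continuous fun ξ : ℝ => σhi * (|ξ| + B * |ξ| ^ (r - 1)) := by
          have := (Real.continuous_rpow_const (by linarith : 0 ≤ r - 1)).comp continuous_abs
          simp only [Function.comp_def] at this
          fun_prop
        have h2 := this.tendsto 0
        simpa [Real.zero_rpow (by linarith : r - 1 ≠ 0)] using h2
      rw [ContinuousAt, hbneg 0 le_rfl]
      refine tendsto_of_tendsto_of_tendsto_of_le_of_le tendsto_const_nhds hlim hbnn fun ξ => ?_
      rcases le_or_gt ξ 0 with h | h
      · rw [hbneg ξ h]; positivity
      · simpa [abs_of_pos h] using hupp ξ h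
    · have h1 : ContinuousAt (fun ξ => (σ x ξ).toReal * ξ) ξ := by
        refine ContinuousAt.mul ?_ continuousAt_id
        have h2 : ContinuousAt EReal.toReal (σ x ξ) :=
          EReal.continuousOn_toReal.continuousAt
            ((isClosed_singleton.union isClosed_singleton).isOpen_compl.mem_nhds
              (by simp [htop ξ h, hbot ξ h]))
        exact ContinuousAt.comp (g := EReal.toReal) (f := σ x) h2
          (hxc.continuousAt (Ioi_mem_nhds h))
      refine h1.congr ?_
      filter_upwards [Ioi_mem_nhds h] with y hy
      exact (hbpos y hy).symm
  refine ⟨b, hcont, hbneg, hbpos, hlow, fun ξ hξ => ?_, fun s hs => ?_⟩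
  · rcases le_or_gt 2 r with h | h
    · refine (hupp ξ hξ).trans ?_
      have h1 : ξ ≤ 1 + ξ ^ (r - 1) := by
        rcases le_total ξ 1 with h2 | h2
        · have : 0 ≤ ξ ^ (r - 1) := by positivity
          linarith
        · have := Real.rpow_le_rpow_of_exponent_le h2 (by linarith : 1 ≤ r - 1)
          rw [Real.rpow_one] at this
          linarith
      nlinarith [mul_pos hhi hB]
    · have h1 := (hx ξ hξ).2.2 h
      rw [← hcoe ξ hξ, EReal.coe_le_coe_iff] at h1
      have h2 := mul_le_mul_of_nonneg_right h1 hξ.le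
      rw [mul_assoc, hpow ξ hξ] at h2
      rw [hbpos ξ hξ]
      have : 0 ≤ ξ ^ (r - 1) := by positivity
      nlinarith [mul_pos hhi hB, mul_nonneg hhi.le this]
  · rw [energyDensity, intervalIntegral.integral_of_le hs,
      ofReal_integral_eq_lintegral_ofReal
        (hcont.integrableOn_Icc.mono_set Ioc_subset_Icc_self) (ae_of_all _ hbnn)]
    refine setLIntegral_congr_fun measurableSet_Ioc fun ξ hξ => ?_
    rw [hbpos ξ hξ.1, EReal.toENNReal_of_ne_top (htop ξ hξ.1), ENNReal.ofReal_mul]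
    have h := (hx ξ hξ.1).1
    rw [← hcoe ξ hξ.1, EReal.coe_le_coe_iff] at h
    exact le_trans (by have := hξ.1; positivity) h

namespace IsFlux

variable {r lo hi : ℝ} {σ : E n → ℝ → EReal} {x : E n} {b : ℝ → ℝ}

theorem nonneg (h : IsFlux r lo hi σ x b) (hlo : 0 < lo) (ξ : ℝ) : 0 ≤ b ξ := by
  rcases le_or_gt ξ 0 with h0 | h0
  · rw [h.eq_zero ξ h0]
  · exact le_trans (by positivity) (h.lower ξ h0)

theorem integral_nonneg (h : IsFlux r lo hi σ x b) (hlo : 0 < lo) {s : ℝ} (hs : 0 ≤ s) :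
    0 ≤ ∫ ξ in (0 : ℝ)..s, b ξ :=
  intervalIntegral.integral_nonneg hs fun ξ _ => h.nonneg hlo ξ

theorem lower_integral (h : IsFlux r lo hi σ x b) (hr : 1 < r) {s : ℝ} (hs : 0 ≤ s) :
    lo / r * s ^ r ≤ ∫ ξ in (0 : ℝ)..s, b ξ := by
  have h1 : ∫ ξ in (0 : ℝ)..s, lo * ξ ^ (r - 1) = lo / r * s ^ r := by
    rw [intervalIntegral.integral_const_mul, integral_rpow (Or.inl (by linarith)),
      sub_add_cancel, Real.zero_rpow (by linarith)]
    ring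
  rw [← h1]
  refine intervalIntegral.integral_mono_on hs
    (((Real.continuous_rpow_const (by linarith)).const_mul lo).intervalIntegrable _ _)
    (h.continuous.intervalIntegrable _ _) fun ξ hξ => ?_
  rcases hξ.1.eq_or_lt with h0 | h0
  · rw [← h0, h.eq_zero 0 le_rfl, Real.zero_rpow (by linarith), mul_zero]
  · exact h.lower ξ h0

theorem upper_integral (h : IsFlux r lo hi σ x b) (hr : 1 < r) (hhi : 0 < hi) {s : ℝ}
    (hs : 0 ≤ s) : ∫ ξ in (0 : ℝ)..s, b ξ ≤ 2 * hi * (1 + s ^ r) := by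
  have h1 : ∫ ξ in (0 : ℝ)..s, b ξ ≤ ∫ _ in (0 : ℝ)..s, hi * (1 + s ^ (r - 1)) := by
    refine intervalIntegral.integral_mono_on hs (h.continuous.intervalIntegrable _ _)
      (by simp) fun ξ hξ => ?_
    rcases hξ.1.eq_or_lt with h0 | h0
    · rw [← h0, h.eq_zero 0 le_rfl]; positivity
    · refine (h.upper ξ h0).trans ?_
      have := Real.rpow_le_rpow h0.le hξ.2 (by linarith : 0 ≤ r - 1)
      gcongr
  refine h1.trans ?_
  rw [intervalIntegral.integral_const, smul_eq_mul, sub_zero]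
  rcases hs.eq_or_lt with rfl | hs0
  · rw [zero_mul]; positivity
  · have h2 : s * s ^ (r - 1) = s ^ r := by
      rw [← Real.rpow_one_add' hs (by linarith)]; congr 1; ring
    have h3 : s ≤ 1 + s ^ r := by
      rcases le_total s 1 with h4 | h4
      · have : 0 ≤ s ^ r := by positivity
        linarith
      · have := Real.rpow_le_rpow_of_exponent_le h4 hr.le
        rw [Real.rpow_one] at this
        linarith
    nlinarith [mul_pos hhi hs0]

end IsFlux

/-- What the direct method needs to know about the energy density on `S`, for fields in `L^r`. -/
structure IsUniformlyConvexEnergy (r : ℝ) (S : Set (E n)) (σ : E n → ℝ → EReal) : Prop where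
  aemeasurable : ∀ G : E n → E n, AEMeasurable G (volume.restrict S) →
    AEMeasurable (fun x => energyDensity σ x ‖G x‖) (volume.restrict S)
  continuousOn : ∀ᵐ x ∂(volume.restrict S), ContinuousOn (energyDensity σ x) (Ici 0)
  coercive : ∃ c : NNReal, ∀ᵐ x ∂(volume.restrict S), ∀ e : E n,
    ‖e‖ₑ ^ r ≤ c * (1 + energyDensity σ x ‖e‖)
  uniform : ∀ ε : NNReal, ε ≠ 0 → ∃ C₀ : NNReal, ∀ C : NNReal, C₀ ≤ C →
    ∀ᵐ x ∂(volume.restrict S), ∀ e₁ e₂ : E n,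
      ‖e₁ - e₂‖ₑ ^ r + C * energyDensity σ x ‖(2⁻¹ : ℝ) • (e₁ + e₂)‖ ≤
        ε * (1 + energyDensity σ x ‖e₁‖ + energyDensity σ x ‖e₂‖) +
          C * ((energyDensity σ x ‖e₁‖ + energyDensity σ x ‖e₂‖) / 2)

/-- This gluing is the reason why the convexity estimate is required for all large `C`: two phases
have different thresholds, and their maximum serves both. -/
theorem IsUniformlyConvexEnergy.union {r : ℝ} {S T : Set (E n)} {σ : E n → ℝ → EReal}
    (hS : IsUniformlyConvexEnergy r S σ) (hT : IsUniformlyConvexEnergy r T σ) :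
    IsUniformlyConvexEnergy r (S ∪ T) σ where
  aemeasurable G hG := aemeasurable_union_iff.2
    ⟨hS.aemeasurable G (aemeasurable_union_iff.1 hG).1,
      hT.aemeasurable G (aemeasurable_union_iff.1 hG).2⟩
  continuousOn := (ae_restrict_union_iff _ _ _).2 ⟨hS.continuousOn, hT.continuousOn⟩
  coercive := by
    obtain ⟨c, hc⟩ := hS.coercive
    obtain ⟨c', hc'⟩ := hT.coercive
    refine ⟨max c c', (ae_restrict_union_iff _ _ _).2 ⟨?_, ?_⟩⟩
    · filter_upwards [hc] with x hx e
      exact (hx e).trans (by gcongr; exact le_max_left _ _)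
    · filter_upwards [hc'] with x hx e
      exact (hx e).trans (by gcongr; exact le_max_right _ _)
  uniform ε hε := by
    obtain ⟨c, hc⟩ := hS.uniform ε hε
    obtain ⟨c', hc'⟩ := hT.uniform ε hε
    exact ⟨max c c', fun C hC => (ae_restrict_union_iff _ _ _).2
      ⟨hc C ((le_max_left _ _).trans hC), hc' C ((le_max_right _ _).trans hC)⟩⟩

theorem enorm_rpow_eq_ofReal (e : E n) {r : ℝ} (hr : 0 ≤ r) :
    ‖e‖ₑ ^ r = ENNReal.ofReal (‖e‖ ^ r) := by
  rw [← ofReal_norm, ENNReal.ofReal_rpow_of_nonneg (norm_nonneg _) hr]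

theorem energyDensity_le {p : ℝ} (hp : 1 < p) {S : Set (E n)} {σ : E n → ℝ → EReal}
    (hc : IsCaratheodory S σ) (hg : HasGrowth p S σ) :
    ∃ C : NNReal, ∀ᵐ x ∂(volume.restrict S), ∀ e : E n,
      energyDensity σ x ‖e‖ ≤ C * (1 + ‖e‖ₑ ^ p) := by
  obtain ⟨lo, hi, hlo, hhi, h⟩ := exists_isFlux hp hc hg
  refine ⟨(2 * hi).toNNReal, ?_⟩
  filter_upwards [h] with x ⟨b, hb⟩ e
  rw [hb.energyDensity_eq _ (norm_nonneg e), enorm_rpow_eq_ofReal e (by linarith),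
    ← ENNReal.ofReal_one, ← ENNReal.ofReal_add zero_le_one (by positivity),
    show ((2 * hi).toNNReal : ℝ≥0∞) = ENNReal.ofReal (2 * hi) from rfl,
    ← ENNReal.ofReal_mul (by positivity)]
  exact ENNReal.ofReal_le_ofReal (hb.upper_integral hp hhi (norm_nonneg e))

/-- The p-th powers in `exists_uniform_convexity` are absorbed by the coercive lower bound Q ≥
(lo/p)|e|^p. Nonnegativity of the gap permits replacing the constant by any larger one. Since the
values are extended nonnegative, the midpoint term is moved to the left instead of being subtracted.
-/
theorem isUniformlyConvexEnergy {r p : ℝ} (hr : 0 < r) (hrp : r ≤ p) (hp : 1 < p)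
    {S : Set (E n)} {σ : E n → ℝ → EReal} (hc : IsCaratheodory S σ) (hg : HasGrowth p S σ)
    (hm : IsStronglyMonotone p S σ) : IsUniformlyConvexEnergy r S σ := by
  obtain ⟨lo, hi, hlo, hhi, hflux⟩ := exists_isFlux hp hc hg
  obtain ⟨κ, hκ, hm⟩ := hm
  refine ⟨fun G hG => aemeasurable_energyDensity hc hG.norm, ?_, ?_, fun ε hε => ?_⟩
  · filter_upwards [hflux] with x ⟨b, hb⟩
    have h1 : Continuous fun s => ENNReal.ofReal (∫ ξ in (0 : ℝ)..s, b ξ) :=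
      ENNReal.continuous_ofReal.comp (intervalIntegral.continuous_primitive
        (fun u v => hb.continuous.intervalIntegrable u v) 0)
    exact h1.continuousOn.congr fun s hs => hb.energyDensity_eq s hs
  · refine ⟨(1 + p / lo).toNNReal, ?_⟩
    filter_upwards [hflux] with x ⟨b, hb⟩ e
    have h1 := hb.lower_integral hp (norm_nonneg e)
    have h2 := rpow_le_add_mul_rpow one_pos hr hrp (norm_nonneg e)
    rw [Real.one_rpow, one_mul] at h2
    have h3 := hb.integral_nonneg hlo (norm_nonneg e)
    rw [hb.energyDensity_eq _ (norm_nonneg e), enorm_rpow_eq_ofReal e hr.le, ← ENNReal.ofReal_one,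
      ← ENNReal.ofReal_add zero_le_one h3,
      show ((1 + p / lo).toNNReal : ℝ≥0∞) = ENNReal.ofReal (1 + p / lo) from rfl,
      ← ENNReal.ofReal_mul (by positivity)]
    refine ENNReal.ofReal_le_ofReal ?_
    have h4 : ‖e‖ ^ p ≤ p / lo * ∫ ξ in (0 : ℝ)..‖e‖, b ξ := by
      rw [div_mul_eq_mul_div, le_div_iff₀ hlo]
      rw [div_mul_eq_mul_div, div_le_iff₀ (by linarith)] at h1
      linarith
    have h5 : 0 < p / lo := by positivity
    nlinarith
  · have hε0 : 0 < (ε : ℝ) := by exact_mod_cast pos_iff_ne_zero.2 hε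
    -- Dividing by `1 + p / lo` compensates for the replacement of ‖e‖^p by p/lo times the
    -- potential.
    set δ : ℝ := ε / (1 + p / lo) with hδ
    have hpl : 0 < p / lo := by positivity
    obtain ⟨K, hK, huc⟩ := exists_uniform_convexity (n := n) hr hrp hp hκ
      (by positivity : 0 < δ)
    refine ⟨K.toNNReal, fun C hC => ?_⟩
    have hKC : K ≤ C := Real.toNNReal_le_iff_le_coe.1 hC
    filter_upwards [hflux, hm] with x ⟨b, hb⟩ hmx e₁ e₂
    have hb' := hb.eq_zero 0 le_rfl
    have hx : StrongMonotoneField p κ fun e : E n => (σ x ‖e‖).toReal • e := hmx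
    have h1 := huc b (fun ξ => (σ x ξ).toReal) hb.continuous hb' hb.eq_mul hx e₁ e₂
    have hgap : (∫ ξ in (0 : ℝ)..‖(2⁻¹ : ℝ) • (e₁ + e₂)‖, b ξ) ≤
        ((∫ ξ in (0 : ℝ)..‖e₁‖, b ξ) + ∫ ξ in (0 : ℝ)..‖e₂‖, b ξ) / 2 := by
      have he₁ : (2⁻¹ : ℝ) • (e₁ + e₂) + (2⁻¹ : ℝ) • (e₁ - e₂) = e₁ := by module
      have he₂ : (2⁻¹ : ℝ) • (e₁ + e₂) - (2⁻¹ : ℝ) • (e₁ - e₂) = e₂ := by module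
      rcases le_or_gt 2 p with h2 | h2
      · have h := gap_of_two_le hb.continuous hb' hb.eq_mul h2 hx ((2⁻¹ : ℝ) • (e₁ + e₂))
          ((2⁻¹ : ℝ) • (e₁ - e₂))
        rw [he₁, he₂] at h
        exact le_trans (le_add_of_nonneg_right (by positivity)) h
      · have h := gap_of_lt_two hb.continuous hb' hb.eq_mul hκ h2 hx ((2⁻¹ : ℝ) • (e₁ + e₂))
          ((2⁻¹ : ℝ) • (e₁ - e₂))
        rw [he₁, he₂] at h
        exact le_trans (le_add_of_nonneg_right (by positivity)) h
    have hl₁ := hb.lower_integral hp (norm_nonneg e₁)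
    have hl₂ := hb.lower_integral hp (norm_nonneg e₂)
    have hn₁ := hb.integral_nonneg hlo (norm_nonneg e₁)
    have hn₂ := hb.integral_nonneg hlo (norm_nonneg e₂)
    have hn₃ := hb.integral_nonneg hlo (norm_nonneg ((2⁻¹ : ℝ) • (e₁ + e₂)))
    rw [hb.energyDensity_eq _ (norm_nonneg _), hb.energyDensity_eq _ (norm_nonneg _),
      hb.energyDensity_eq _ (norm_nonneg _), enorm_rpow_eq_ofReal _ hr.le]
    set I₁ := ∫ ξ in (0 : ℝ)..‖e₁‖, b ξ
    set I₂ := ∫ ξ in (0 : ℝ)..‖e₂‖, b ξ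
    set I₃ := ∫ ξ in (0 : ℝ)..‖(2⁻¹ : ℝ) • (e₁ + e₂)‖, b ξ
    have hreal : ‖e₁ - e₂‖ ^ r + C * I₃ ≤ ε * (1 + I₁ + I₂) + C * ((I₁ + I₂) / 2) := by
      have h4 : ∀ (e : E n) (I : ℝ), lo / p * ‖e‖ ^ p ≤ I → ‖e‖ ^ p ≤ p / lo * I :=
        fun e I h => by
          rw [div_mul_eq_mul_div, le_div_iff₀ hlo]
          rw [div_mul_eq_mul_div, div_le_iff₀ (by linarith)] at h
          linarith
      have h5 : δ * (1 + ‖e₁‖ ^ p + ‖e₂‖ ^ p) ≤ δ * ((1 + p / lo) * (1 + I₁ + I₂)) := by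
        have := h4 e₁ I₁ hl₁
        have := h4 e₂ I₂ hl₂
        have : 0 ≤ δ := by positivity
        gcongr
        nlinarith
      have h6 : δ * ((1 + p / lo) * (1 + I₁ + I₂)) = ε * (1 + I₁ + I₂) := by
        rw [hδ]; field_simp
      have h7 : K * ((I₁ + I₂) / 2 - I₃) ≤ C * ((I₁ + I₂) / 2 - I₃) :=
        mul_le_mul_of_nonneg_right hKC (by linarith)
      linarith
    have hcoe : ∀ a : NNReal, (a : ℝ≥0∞) = ENNReal.ofReal a := fun a => by simp
    have hhalf : ENNReal.ofReal I₁ / 2 + ENNReal.ofReal I₂ / 2 = ENNReal.ofReal ((I₁ + I₂) / 2) := by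
      rw [← ENNReal.add_div, ← ENNReal.ofReal_add hn₁ hn₂, ENNReal.ofReal_div_of_pos two_pos,
        ENNReal.ofReal_ofNat]
    rw [ENNReal.add_div, hhalf, hcoe C, hcoe ε, ← ENNReal.ofReal_mul C.coe_nonneg, ← ENNReal.ofReal_add (by positivity)
      (mul_nonneg C.coe_nonneg hn₃), ← ENNReal.ofReal_one, ← ENNReal.ofReal_add zero_le_one hn₁,
      ← ENNReal.ofReal_add (by positivity) hn₂,
      ← ENNReal.ofReal_mul ε.coe_nonneg, ← ENNReal.ofReal_mul C.coe_nonneg,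
      ← ENNReal.ofReal_add (by positivity) (by positivity)]
    exact ENNReal.ofReal_le_ofReal hreal

end EnergyDensity

/-! ### Calculus of weak gradients and Sobolev functions. -/

section Sobolev

variable {n : ℕ} {U : Set (E n)}

theorem integrable_smul_of_tsupport_subset {F : Type*} [NormedAddCommGroup F] [NormedSpace ℝ F]
    {u : E n → F} (hu : LocallyIntegrableOn u U volume) {ψ : E n → ℝ} (hψ : Continuous ψ)
    (hc : HasCompactSupport ψ) (hs : tsupport ψ ⊆ U) : Integrable (fun x => ψ x • u x) volume := by
  have h1 : IntegrableOn (fun x => ψ x • u x) (tsupport ψ) volume :=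
    (hu.integrableOn_compact_subset hs hc).continuousOn_smul hψ.continuousOn hc
  refine (integrableOn_iff_integrable_of_support_subset fun x hx => ?_).1 h1
  exact subset_tsupport ψ fun h => hx (by simp [h])

theorem integrable_mul_of_tsupport_subset {u : E n → ℝ} (hu : LocallyIntegrableOn u U volume)
    {ψ : E n → ℝ} (hψ : Continuous ψ) (hc : HasCompactSupport ψ) (hs : tsupport ψ ⊆ U) :
    Integrable (fun x => u x * ψ x) (volume.restrict U) := by
  have h := (integrable_smul_of_tsupport_subset hu hψ hc hs).restrict (s := U)
  simpa [mul_comm] using h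

theorem tsupport_fderiv_apply_subset_of {φ : E n → ℝ} (hs : tsupport φ ⊆ U) (v : E n) :
    tsupport (fun x => fderiv ℝ φ x v) ⊆ U := by
  refine subset_trans (closure_mono fun x hx => ?_) ((tsupport_fderiv_subset ℝ).trans hs)
  exact fun h => hx (by simp [h])

theorem locallyIntegrableOn_inner {G : E n → E n} (hG : LocallyIntegrableOn G U volume) (v : E n) :
    LocallyIntegrableOn (fun x => inner ℝ (G x) v) U volume := fun x hx =>
  let ⟨s, hs, h⟩ := hG x hx
  ⟨s, hs, h.inner_const v⟩

namespace HasWeakGradient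

variable {u w : E n → ℝ} {G H : E n → E n}

theorem integrable_mul_fderiv (h : HasWeakGradient U u G) {φ : E n → ℝ}
    (hφ : ContDiff ℝ (⊤ : ℕ∞) φ) (hc : HasCompactSupport φ) (hs : tsupport φ ⊆ U) (v : E n) :
    Integrable (fun x => u x * fderiv ℝ φ x v) (volume.restrict U) :=
  integrable_mul_of_tsupport_subset h.1
    ((hφ.continuous_fderiv (by simp)).clm_apply continuous_const) (hc.fderiv_apply ℝ v)
    (tsupport_fderiv_apply_subset_of hs v)

theorem integrable_inner_mul (h : HasWeakGradient U u G) {φ : E n → ℝ}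
    (hφ : ContDiff ℝ (⊤ : ℕ∞) φ) (hc : HasCompactSupport φ) (hs : tsupport φ ⊆ U) (v : E n) :
    Integrable (fun x => inner ℝ (G x) v * φ x) (volume.restrict U) :=
  integrable_mul_of_tsupport_subset (locallyIntegrableOn_inner h.2.1 v) hφ.continuous hc hs

/-- The fundamental lemma of the calculus of variations for the vector field `G - H`; the vanishing
of its vector integrals is checked against every direction `v`. -/
theorem ae_eq (hU : IsOpen U) (h₁ : HasWeakGradient U u G) (h₂ : HasWeakGradient U u H) :
    G =ᵐ[volume.restrict U] H := by
  have hD := h₁.2.1.sub h₂.2.1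
  have key := hU.ae_eq_zero_of_integral_contDiff_smul_eq_zero hD fun g hg hc hs => by
    refine ext_inner_right ℝ fun v => ?_
    have hi := integrable_smul_of_tsupport_subset hD hg.continuous hc hs
    rw [real_inner_comm, ← integral_inner hi v, inner_zero_left]
    have hz : ∀ x ∉ U, inner ℝ v (g x • (G - H) x) = 0 := fun x hx => by
      rw [image_eq_zero_of_notMem_tsupport (fun h => hx (hs h)), zero_smul, inner_zero_right]
    rw [← setIntegral_eq_integral_of_forall_compl_eq_zero hz]
    have e₁ := h₁.2.2 g hg hc hs v
    have e₂ := h₂.2.2 g hg hc hs v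
    rw [e₁, neg_inj] at e₂
    have : ∀ x, inner ℝ v (g x • (G - H) x) = inner ℝ (G x) v * g x - inner ℝ (H x) v * g x :=
      fun x => by
        rw [real_inner_comm, inner_smul_left, Pi.sub_apply, inner_sub_left]
        simp only [conj_trivial]
        ring
    simp only [this]
    rw [integral_sub (h₁.integrable_inner_mul hg hc hs v) (h₂.integrable_inner_mul hg hc hs v),
      e₂, sub_self]
  filter_upwards [(ae_restrict_iff' hU.measurableSet).2 key] with x hx
  exact sub_eq_zero.1 hx

theorem add (h₁ : HasWeakGradient U u G) (h₂ : HasWeakGradient U w H) :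
    HasWeakGradient U (u + w) (G + H) := by
  refine ⟨h₁.1.add h₂.1, h₁.2.1.add h₂.2.1, fun φ hφ hc hs v => ?_⟩
  simp only [Pi.add_apply, add_mul, inner_add_left]
  rw [integral_add (h₁.integrable_mul_fderiv hφ hc hs v) (h₂.integrable_mul_fderiv hφ hc hs v),
    integral_add (h₁.integrable_inner_mul hφ hc hs v) (h₂.integrable_inner_mul hφ hc hs v),
    h₁.2.2 φ hφ hc hs v, h₂.2.2 φ hφ hc hs v]
  ring

theorem const_smul (h : HasWeakGradient U u G) (c : ℝ) :
    HasWeakGradient U (c • u) (c • G) := by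
  refine ⟨h.1.smul c, h.2.1.smul c, fun φ hφ hc hs v => ?_⟩
  simp only [Pi.smul_apply, smul_eq_mul, mul_assoc, inner_smul_left, conj_trivial,
    integral_const_mul]
  rw [h.2.2 φ hφ hc hs v]
  ring

theorem sub (h₁ : HasWeakGradient U u G) (h₂ : HasWeakGradient U w H) :
    HasWeakGradient U (u - w) (G - H) := by
  have := h₁.add (h₂.const_smul (-1))
  simpa [sub_eq_add_neg] using this

theorem mono {V : Set (E n)} (hV : V ⊆ U) (hUm : MeasurableSet U)
    (h : HasWeakGradient U u G) : HasWeakGradient V u G := by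
  refine ⟨h.1.mono_set hV, h.2.1.mono_set hV, fun φ hφ hc hs v => ?_⟩
  have h1 := h.2.2 φ hφ hc (hs.trans hV) v
  have hz : ∀ x ∉ V, φ x = 0 := fun x hx =>
    image_eq_zero_of_notMem_tsupport fun h => hx (hs h)
  have hz' : ∀ x ∉ V, fderiv ℝ φ x v = 0 := fun x hx =>
    image_eq_zero_of_notMem_tsupport (f := fun x => fderiv ℝ φ x v) fun h =>
      hx (tsupport_fderiv_apply_subset_of hs v h)
  rwa [setIntegral_eq_of_subset_of_forall_sdiff_eq_zero hUm hV
      (fun x hx => by rw [hz' x hx.2, mul_zero]),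
    setIntegral_eq_of_subset_of_forall_sdiff_eq_zero hUm hV
      (fun x hx => by rw [hz x hx.2, mul_zero])] at h1

theorem of_contDiff {φ : E n → ℝ} (hφ : ContDiff ℝ 1 φ) : HasWeakGradient U φ (gradient φ) := by
  have hgc : Continuous (gradient φ) :=
    (InnerProductSpace.toDual ℝ (E n)).symm.continuous.comp (hφ.continuous_fderiv one_ne_zero)
  refine ⟨(hφ.continuous.locallyIntegrable).locallyIntegrableOn _,
    hgc.locallyIntegrable.locallyIntegrableOn _, fun ψ hψ hc hs v => ?_⟩
  simp only [inner_gradient_left]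
  have hz : ∀ x ∉ U, ψ x = 0 := fun x hx =>
    image_eq_zero_of_notMem_tsupport fun h => hx (hs h)
  have hz' : ∀ x ∉ U, fderiv ℝ ψ x v = 0 := fun x hx =>
    image_eq_zero_of_notMem_tsupport (f := fun x => fderiv ℝ ψ x v) fun h =>
      hx (tsupport_fderiv_apply_subset_of hs v h)
  rw [setIntegral_eq_integral_of_forall_compl_eq_zero (fun x hx => by rw [hz' x hx, mul_zero]),
    setIntegral_eq_integral_of_forall_compl_eq_zero (fun x hx => by rw [hz x hx, mul_zero])]
  have hφc := (hφ.continuous_fderiv one_ne_zero).clm_apply (continuous_const (y := v))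
  have hψc := (hψ.continuous_fderiv (by simp)).clm_apply (continuous_const (y := v))
  exact integral_mul_fderiv_eq_neg_fderiv_mul_of_integrable
    ((hφc.mul hψ.continuous).integrable_of_hasCompactSupport hc.mul_left)
    ((hφ.continuous.mul hψc).integrable_of_hasCompactSupport (hc.fderiv_apply ℝ v).mul_left)
    ((hφ.continuous.mul hψ.continuous).integrable_of_hasCompactSupport hc.mul_left)
    (fun x _ => hφ.differentiable one_ne_zero x)
    (fun x _ => hψ.differentiable (by simp) x)

/-- The product rule with a smooth factor. -/
theorem smooth_mul (hU : IsOpen U) (h : HasWeakGradient U u G) {χ : E n → ℝ}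
    (hχ : ContDiff ℝ (⊤ : ℕ∞) χ) :
    HasWeakGradient U (fun x => χ x * u x) (fun x => χ x • G x + u x • gradient χ x) := by
  have hgc : Continuous (gradient χ) :=
    (InnerProductSpace.toDual ℝ (E n)).symm.continuous.comp (hχ.continuous_fderiv (by simp))
  have hlc := hU.isLocallyClosed
  refine ⟨h.1.continuousOn_mul hχ.continuous.continuousOn hlc,
    (h.2.1.continuousOn_smul hlc hχ.continuous.continuousOn).add
      (h.1.smul_continuousOn hlc hgc.continuousOn), fun φ hφ hc hs v => ?_⟩
  have hprod : ContDiff ℝ (⊤ : ℕ∞) fun x => χ x * φ x := hχ.mul hφ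
  have hpc : HasCompactSupport fun x => χ x * φ x := hc.mul_left
  have hps : tsupport (fun x => χ x * φ x) ⊆ U :=
    (closure_mono (Function.support_mul_subset_right _ _)).trans hs
  have h1 := h.2.2 _ hprod hpc hps v
  have hder : ∀ x, fderiv ℝ (fun x => χ x * φ x) x v =
      χ x * fderiv ℝ φ x v + φ x * fderiv ℝ χ x v := fun x => by
    rw [fderiv_fun_mul (hχ.differentiable (by simp) x) (hφ.differentiable (by simp) x)]
    simp
  have hi₁ : Integrable (fun x => u x * (χ x * fderiv ℝ φ x v)) (volume.restrict U) :=
    integrable_mul_of_tsupport_subset h.1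
      (hχ.continuous.mul ((hφ.continuous_fderiv (by simp)).clm_apply continuous_const))
      (hc.fderiv_apply ℝ v).mul_left
      ((closure_mono (Function.support_mul_subset_right _ _)).trans
        (tsupport_fderiv_apply_subset_of hs v))
  have hi₂ : Integrable (fun x => u x * (φ x * fderiv ℝ χ x v)) (volume.restrict U) :=
    integrable_mul_of_tsupport_subset h.1
      (hφ.continuous.mul ((hχ.continuous_fderiv (by simp)).clm_apply continuous_const))
      hc.mul_right ((closure_mono (Function.support_mul_subset_left _ _)).trans hs)
  have hi₃ := h.integrable_inner_mul hprod hpc hps v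
  simp only [hder, mul_add] at h1
  rw [integral_add hi₁ hi₂] at h1
  have e₁ : ∀ x, χ x * u x * fderiv ℝ φ x v = u x * (χ x * fderiv ℝ φ x v) := fun x => by ring
  have e₂ : ∀ x, inner ℝ (χ x • G x + u x • gradient χ x) v * φ x =
      inner ℝ (G x) v * (χ x * φ x) + u x * (φ x * fderiv ℝ χ x v) := fun x => by
    rw [inner_add_left, inner_smul_left, inner_smul_left, inner_gradient_left]
    simp only [conj_trivial]
    ring
  simp only [e₁, e₂]
  rw [integral_add hi₃ hi₂]
  linarith

/-- On a finite measure space L^p convergence implies L^1 convergence. A test function and its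
derivatives are bounded, so both sides of the defining identity pass to the limit. -/
theorem of_tendsto {p : ℝ≥0∞} (hp : 1 ≤ p) [IsFiniteMeasure (volume.restrict U)]
    {us : ℕ → E n → ℝ} {Gs : ℕ → E n → E n} (h : ∀ k, HasWeakGradient U (us k) (Gs k))
    (hus : ∀ k, MemLp (us k) p (volume.restrict U)) (hGs : ∀ k, MemLp (Gs k) p (volume.restrict U))
    (hu : MemLp u p (volume.restrict U)) (hG : MemLp G p (volume.restrict U))
    (htu : Tendsto (fun k => eLpNorm (us k - u) p (volume.restrict U)) atTop (𝓝 0))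
    (htG : Tendsto (fun k => eLpNorm (Gs k - G) p (volume.restrict U)) atTop (𝓝 0)) :
    HasWeakGradient U u G := by
  have key : ∀ {F : Type} [NormedAddCommGroup F] [NormedSpace ℝ F] (fs : ℕ → E n → F) (f : E n → F)
      (gs : ℕ → E n → ℝ) (g : E n → ℝ) (C : ℝ), (∀ k, Integrable (gs k) (volume.restrict U)) →
      Integrable g (volume.restrict U) → (∀ k, MemLp (fs k) p (volume.restrict U)) →
      MemLp f p (volume.restrict U) →
      Tendsto (fun k => eLpNorm (fs k - f) p (volume.restrict U)) atTop (𝓝 0) →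
      (∀ k x, ‖gs k x - g x‖ ≤ C * ‖fs k x - f x‖) →
      Tendsto (fun k => ∫ x in U, gs k x) atTop (𝓝 (∫ x in U, g x)) := by
    intro F _ _ fs f gs g C hgs hg hfs hf ht hle
    refine tendsto_integral_of_L1' g hg.aestronglyMeasurable (Eventually.of_forall hgs) ?_
    have hC : ENNReal.ofReal C * (volume.restrict U) univ ^
        (1 / (1 : ℝ≥0∞).toReal - 1 / p.toReal) ≠ ⊤ := by
      refine ENNReal.mul_ne_top ENNReal.ofReal_ne_top
        (ENNReal.rpow_ne_top_of_nonneg ?_ (measure_ne_top _ _))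
      rcases eq_or_ne p ⊤ with rfl | hpt
      · simp
      · have : 1 ≤ p.toReal := by simpa using ENNReal.toReal_mono hpt hp
        rw [ENNReal.toReal_one, sub_nonneg]
        exact one_div_le_one_div_of_le one_pos this
    have h0 := ENNReal.Tendsto.const_mul ht (Or.inr hC)
    rw [mul_zero] at h0
    refine tendsto_of_tendsto_of_tendsto_of_le_of_le tendsto_const_nhds h0 (fun _ => zero_le)
      fun k => ?_
    refine (eLpNorm_le_mul_eLpNorm_of_ae_le_mul (ae_of_all _ (hle k)) 1).trans ?_
    rw [mul_assoc]
    gcongr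
    rw [mul_comm]
    exact eLpNorm_le_eLpNorm_mul_rpow_measure_univ hp
      ((hfs k).aestronglyMeasurable.sub hf.aestronglyMeasurable)
  have hloc : ∀ {F : Type} [NormedAddCommGroup F] (f : E n → F), MemLp f p (volume.restrict U) →
      LocallyIntegrableOn f U volume := fun f hf =>
    (show IntegrableOn f U volume from hf.integrable hp).locallyIntegrableOn
  refine ⟨hloc u hu, hloc G hG, fun φ hφ hc hs v => ?_⟩
  have hφ' : Continuous fun x => fderiv ℝ φ x v :=
    (hφ.continuous_fderiv (by simp)).clm_apply continuous_const
  obtain ⟨C, hC⟩ := (hc.fderiv_apply ℝ v).exists_bound_of_continuous hφ'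
  obtain ⟨C', hC'⟩ := hc.exists_bound_of_continuous hφ.continuous
  have h1 := key us u (fun k x => us k x * fderiv ℝ φ x v) (fun x => u x * fderiv ℝ φ x v) C
    (fun k => (h k).integrable_mul_fderiv hφ hc hs v)
    (integrable_mul_of_tsupport_subset (hloc u hu) hφ' (hc.fderiv_apply ℝ v)
      (tsupport_fderiv_apply_subset_of hs v)) hus hu htu (fun k x => by
      rw [← sub_mul, norm_mul, mul_comm]
      gcongr
      exact hC x)
  have h2 := key Gs G (fun k x => inner ℝ (Gs k x) v * φ x) (fun x => inner ℝ (G x) v * φ x)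
    (‖v‖ * C') (fun k => (h k).integrable_inner_mul hφ hc hs v)
    (integrable_mul_of_tsupport_subset (locallyIntegrableOn_inner (hloc G hG) v) hφ.continuous hc
      hs) hGs hG htG (fun k x => by
      rw [← sub_mul, ← inner_sub_left, norm_mul]
      calc ‖inner ℝ (Gs k x - G x) v‖ * ‖φ x‖ ≤ (‖Gs k x - G x‖ * ‖v‖) * C' := by
            gcongr
            · exact norm_inner_le_norm _ _
            · exact hC' x
        _ = _ := by ring)
  refine tendsto_nhds_unique h1 ?_
  simp only [fun k => (h k).2.2 φ hφ hc hs v]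
  exact h2.neg

end HasWeakGradient

theorem hasWeakGradient_weakGradient {u : E n → ℝ} (h : ∃ G, HasWeakGradient U u G) :
    HasWeakGradient U u (weakGradient U u) := by
  rw [weakGradient, dif_pos h]
  exact h.choose_spec

theorem HasWeakGradient.weakGradient_ae_eq {u : E n → ℝ} {G : E n → E n} (hU : IsOpen U)
    (h : HasWeakGradient U u G) : weakGradient U u =ᵐ[volume.restrict U] G :=
  (hasWeakGradient_weakGradient ⟨G, h⟩).ae_eq hU h

namespace MemW

variable {p : ℝ} {u w : E n → ℝ}

theorem hasWeakGradient (h : MemW p U u) : HasWeakGradient U u (weakGradient U u) :=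
  let ⟨_, G, hG, _⟩ := h
  hasWeakGradient_weakGradient ⟨G, hG⟩

theorem memLp_weakGradient (hU : IsOpen U) (h : MemW p U u) :
    MemLp (weakGradient U u) (ENNReal.ofReal p) (volume.restrict U) := by
  obtain ⟨_, G, hG, hGp⟩ := h
  exact (memLp_congr_ae (hG.weakGradient_ae_eq hU)).2 hGp

theorem add (hU : IsOpen U) (h₁ : MemW p U u) (h₂ : MemW p U w) : MemW p U (u + w) :=
  ⟨h₁.1.add h₂.1, _, h₁.hasWeakGradient.add h₂.hasWeakGradient,
    (h₁.memLp_weakGradient hU).add (h₂.memLp_weakGradient hU)⟩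

theorem sub (hU : IsOpen U) (h₁ : MemW p U u) (h₂ : MemW p U w) : MemW p U (u - w) :=
  ⟨h₁.1.sub h₂.1, _, h₁.hasWeakGradient.sub h₂.hasWeakGradient,
    (h₁.memLp_weakGradient hU).sub (h₂.memLp_weakGradient hU)⟩

theorem const_smul (hU : IsOpen U) (h : MemW p U u) (c : ℝ) : MemW p U (c • u) :=
  ⟨h.1.const_smul c, _, h.hasWeakGradient.const_smul c, (h.memLp_weakGradient hU).const_smul c⟩

theorem weakGradient_add (hU : IsOpen U) (h₁ : MemW p U u) (h₂ : MemW p U w) :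
    weakGradient U (u + w) =ᵐ[volume.restrict U] weakGradient U u + weakGradient U w :=
  (h₁.hasWeakGradient.add h₂.hasWeakGradient).weakGradient_ae_eq hU

theorem weakGradient_sub (hU : IsOpen U) (h₁ : MemW p U u) (h₂ : MemW p U w) :
    weakGradient U (u - w) =ᵐ[volume.restrict U] weakGradient U u - weakGradient U w :=
  (h₁.hasWeakGradient.sub h₂.hasWeakGradient).weakGradient_ae_eq hU

theorem weakGradient_const_smul (hU : IsOpen U) (h : MemW p U u) (c : ℝ) :
    weakGradient U (c • u) =ᵐ[volume.restrict U] c • weakGradient U u :=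
  (h.hasWeakGradient.const_smul c).weakGradient_ae_eq hU

theorem mono_exponent (hU : IsOpen U) [IsFiniteMeasure (volume.restrict U)] {r : ℝ} (hrp : r ≤ p)
    (h : MemW p U u) : MemW r U u :=
  ⟨h.1.mono_exponent (ENNReal.ofReal_le_ofReal hrp), _, h.hasWeakGradient,
    (h.memLp_weakGradient hU).mono_exponent (ENNReal.ofReal_le_ofReal hrp)⟩

theorem mono_set (hU : IsOpen U) {V : Set (E n)} (hV : V ⊆ U) (h : MemW p U u) : MemW p V u :=
  ⟨h.1.mono_measure (Measure.restrict_mono hV le_rfl), _,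
    h.hasWeakGradient.mono hV hU.measurableSet,
    (h.memLp_weakGradient hU).mono_measure (Measure.restrict_mono hV le_rfl)⟩

theorem of_contDiff (hb : Bornology.IsBounded U) {φ : E n → ℝ} (hφ : ContDiff ℝ 1 φ) :
    MemW p U φ := by
  have hcomp : IsCompact (closure U) := hb.isCompact_closure
  have hgc : Continuous (gradient φ) :=
    (InnerProductSpace.toDual ℝ (E n)).symm.continuous.comp (hφ.continuous_fderiv one_ne_zero)
  have key : ∀ {F : Type} [NormedAddCommGroup F] [SecondCountableTopologyEither (E n) F]
      (f : E n → F), Continuous f → MemLp f (ENNReal.ofReal p) (volume.restrict U) := by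
    intro F _ _ f hf
    obtain ⟨C, hC⟩ := hcomp.exists_bound_of_continuousOn hf.continuousOn
    have h1 : MemLp f (ENNReal.ofReal p) (volume.restrict (closure U)) := by
      have : IsFiniteMeasure (volume.restrict (closure U)) := ⟨by simpa using hcomp.measure_lt_top⟩
      exact MemLp.of_bound hf.aestronglyMeasurable C
        ((ae_restrict_iff' isClosed_closure.measurableSet).2 (ae_of_all _ hC))
    exact h1.mono_measure (Measure.restrict_mono subset_closure le_rfl)
  exact ⟨key φ hφ.continuous, _, HasWeakGradient.of_contDiff hφ, key _ hgc⟩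

/-- Multiplication by a smooth compactly supported function is bounded on `W^{1,p}(U)`. -/
theorem smooth_mul (hU : IsOpen U) (hp : 1 ≤ p) {χ : E n → ℝ} (hχ : ContDiff ℝ (⊤ : ℕ∞) χ)
    (hc : HasCompactSupport χ) :
    ∃ C : NNReal, ∀ u, MemW p U u → MemW p U (fun x => χ x * u x) ∧
      sobolevNorm p U (fun x => χ x * u x) ≤ C * sobolevNorm p U u := by
  have hp' : 1 ≤ ENNReal.ofReal p := by simpa using hp
  have hfc := hχ.continuous_fderiv (by simp)
  have hgc : Continuous (gradient χ) :=
    (InnerProductSpace.toDual ℝ (E n)).symm.continuous.comp hfc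
  obtain ⟨C, hC⟩ := hc.exists_bound_of_continuous hχ.continuous
  obtain ⟨C', hC'⟩ := (hc.fderiv ℝ).exists_bound_of_continuous hfc
  have hgn : ∀ x, ‖gradient χ x‖ ≤ C' := fun x => by
    rw [gradient, LinearIsometryEquiv.norm_map]
    exact hC' x
  refine ⟨C.toNNReal + C'.toNNReal, fun u hu => ?_⟩
  have b₁ : ∀ x, ‖χ x * u x‖ ≤ C * ‖u x‖ := fun x => by
    rw [norm_mul]; gcongr; exact hC x
  have b₂ : ∀ x, ‖χ x • weakGradient U u x‖ ≤ C * ‖weakGradient U u x‖ := fun x => by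
    rw [norm_smul]; gcongr; exact hC x
  have b₃ : ∀ x, ‖u x • gradient χ x‖ ≤ C' * ‖u x‖ := fun x => by
    rw [norm_smul, mul_comm]; gcongr; exact hgn x
  have hG := hu.memLp_weakGradient hU
  have m₁ : MemLp (fun x => χ x * u x) (ENNReal.ofReal p) (volume.restrict U) :=
    hu.1.of_le_mul (hχ.continuous.aestronglyMeasurable.mul hu.1.1) (ae_of_all _ b₁)
  have m₂ : MemLp (fun x => χ x • weakGradient U u x) (ENNReal.ofReal p) (volume.restrict U) :=
    hG.of_le_mul (hχ.continuous.aestronglyMeasurable.smul hG.1) (ae_of_all _ b₂)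
  have m₃ : MemLp (fun x => u x • gradient χ x) (ENNReal.ofReal p) (volume.restrict U) :=
    hu.1.of_le_mul (hu.1.1.smul hgc.aestronglyMeasurable) (ae_of_all _ b₃)
  have hw := hu.hasWeakGradient.smooth_mul hU hχ
  refine ⟨⟨m₁, _, hw, m₂.add m₃⟩, ?_⟩
  rw [sobolevNorm, eLpNorm_congr_ae (hw.weakGradient_ae_eq hU), sobolevNorm]
  have n₁ := eLpNorm_le_mul_eLpNorm_of_ae_le_mul (ae_of_all (volume.restrict U) b₁)
    (ENNReal.ofReal p)
  have n₂ := eLpNorm_le_mul_eLpNorm_of_ae_le_mul (ae_of_all (volume.restrict U) b₂)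
    (ENNReal.ofReal p)
  have n₃ := eLpNorm_le_mul_eLpNorm_of_ae_le_mul (ae_of_all (volume.restrict U) b₃)
    (ENNReal.ofReal p)
  have n₄ := eLpNorm_add_le m₂.1 m₃.1 hp'
  refine (add_le_add n₁ (n₄.trans (add_le_add n₂ n₃))).trans ?_
  rw [ENNReal.coe_add, add_mul, mul_add, mul_add,
    show ((C.toNNReal : NNReal) : ℝ≥0∞) = ENNReal.ofReal C from rfl,
    show ((C'.toNNReal : NNReal) : ℝ≥0∞) = ENNReal.ofReal C' from rfl, ← add_assoc]
  gcongr
  exact le_self_add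

end MemW

end Sobolev

/-! ### A Poincaré inequality by chaining segments. -/

section Poincare

variable {n : ℕ}

theorem rpow_lintegral_le_lintegral_rpow {α : Type*} [MeasurableSpace α] {μ : Measure α}
    [IsProbabilityMeasure μ] {p : ℝ} (hp : 1 ≤ p) {f : α → ℝ≥0∞} (hf : AEMeasurable f μ) :
    (∫⁻ x, f x ∂μ) ^ p ≤ ∫⁻ x, f x ^ p ∂μ := by
  have h := eLpNorm'_le_eLpNorm'_of_exponent_le one_pos hp μ hf.aestronglyMeasurable
  simp only [eLpNorm', enorm_eq_self, ENNReal.rpow_one, div_one] at h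
  have h2 := ENNReal.rpow_le_rpow h (by linarith : 0 ≤ p)
  rwa [← ENNReal.rpow_mul, one_div_mul_cancel (by linarith), ENNReal.rpow_one] at h2

/-- The fundamental theorem of calculus along the segment, followed by Jensen's inequality on the
unit interval. -/
theorem enorm_sub_rpow_le {p : ℝ} (hp : 1 ≤ p) {w : E n → ℝ} (hw : ContDiff ℝ 1 w) (x y : E n) :
    ‖w y - w x‖ₑ ^ p ≤
      ‖y - x‖ₑ ^ p * ∫⁻ t in Ioc (0 : ℝ) 1, ‖fderiv ℝ w (x + t • (y - x))‖ₑ ^ p := by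
  have hfc := hw.continuous_fderiv one_ne_zero
  have hder : ∀ t : ℝ, HasDerivAt (fun t : ℝ => w (x + t • (y - x)))
      (fderiv ℝ w (x + t • (y - x)) (y - x)) t := fun t => by
    have hline : HasDerivAt (fun t : ℝ => x + t • (y - x)) (y - x) t := by
      simpa using ((hasDerivAt_id t).smul_const (y - x)).const_add x
    exact (hw.differentiable one_ne_zero _).hasFDerivAt.comp_hasDerivAt t hline
  have hc : Continuous fun t : ℝ => fderiv ℝ w (x + t • (y - x)) := hfc.comp (by fun_prop)
  have h1 := intervalIntegral.integral_eq_sub_of_hasDerivAt (a := 0) (b := 1)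
    (fun t _ => hder t) ((hc.clm_apply continuous_const).intervalIntegrable _ _)
  simp only [one_smul, add_sub_cancel, zero_smul, add_zero] at h1
  have hprob : IsProbabilityMeasure (volume.restrict (Ioc (0 : ℝ) 1)) := ⟨by simp⟩
  have h2 : ‖w y - w x‖ₑ ≤
      ‖y - x‖ₑ * ∫⁻ t in Ioc (0 : ℝ) 1, ‖fderiv ℝ w (x + t • (y - x))‖ₑ := by
    rw [← h1, intervalIntegral.integral_of_le zero_le_one,
      ← lintegral_const_mul _ hc.enorm.measurable]
    refine (enorm_integral_le_lintegral_enorm _).trans (lintegral_mono fun t => ?_)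
    rw [mul_comm]
    exact ContinuousLinearMap.le_opENorm _ _
  refine (ENNReal.rpow_le_rpow h2 (by linarith)).trans ?_
  rw [ENNReal.mul_rpow_of_nonneg _ _ (by linarith)]
  gcongr
  exact rpow_lintegral_le_lintegral_rpow hp hc.enorm.measurable.aemeasurable

/-- The Jacobian of the inverse map is a^{-n} ≤ 2^n. The lower bound on `a` can always be met below,
since one of `t` and `1 - t` is at least 1/2. -/
theorem setLIntegral_comp_affine_le {h : E n → ℝ≥0∞} (hh : Measurable h) {S W : Set (E n)}
    (hW : MeasurableSet W) {a : ℝ} (ha : 2⁻¹ ≤ a) (c : E n) (hS : ∀ x ∈ S, a • x + c ∈ W) :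
    ∫⁻ x in S, h (a • x + c) ≤ 2 ^ n * ∫⁻ x in W, h x := by
  have ha0 : 0 < a := lt_of_lt_of_le (by norm_num) ha
  have hm : Measurable (W.indicator h) := hh.indicator hW
  calc ∫⁻ x in S, h (a • x + c) ≤ ∫⁻ x in S, W.indicator h (a • x + c) := by
        refine setLIntegral_mono (hm.comp (by fun_prop)) fun x hx => ?_
        rw [indicator_of_mem (hS x hx)]
    _ ≤ ∫⁻ x, W.indicator h (a • x + c) := setLIntegral_le_lintegral _ _
    _ = ∫⁻ x, W.indicator h (x + c) ∂(Measure.map (fun x => a • x) volume) := by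
        rw [lintegral_map (f := fun x => W.indicator h (x + c)) (hm.comp (by fun_prop))
          (by fun_prop)]
    _ = ENNReal.ofReal |(a ^ n)⁻¹| * ∫⁻ x in W, h x := by
        rw [Measure.map_addHaar_smul _ ha0.ne', lintegral_smul_measure,
          lintegral_add_right_eq_self (fun x => W.indicator h x) c, lintegral_indicator hW]
        simp
    _ ≤ _ := by
        gcongr
        rw [abs_of_pos (by positivity), ← inv_pow, ← ENNReal.ofReal_ofNat,
          ← ENNReal.ofReal_pow (by norm_num)]
        refine ENNReal.ofReal_le_ofReal ?_
        gcongr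
        exact inv_le_of_inv_le₀ (by norm_num) ha

/-- A Poincaré type estimate between two sets `S` and `D`, all of whose connecting segments lie
in `W`. -/
theorem lintegral_lintegral_enorm_sub_rpow_le {p L : ℝ} (hp : 1 ≤ p) {S D W : Set (E n)}
    (hW : MeasurableSet W) (hS : MeasurableSet S) (hD : MeasurableSet D)
    (hseg : ∀ x ∈ S, ∀ y ∈ D, ∀ t ∈ Ioc (0 : ℝ) 1, x + t • (y - x) ∈ W)
    (hL : ∀ x ∈ S, ∀ y ∈ D, ‖y - x‖ ≤ L) {w : E n → ℝ} (hw : ContDiff ℝ 1 w) :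
    ∫⁻ x in S, ∫⁻ y in D, ‖w y - w x‖ₑ ^ p ≤
      ENNReal.ofReal L ^ p * ((volume S + volume D) * (2 ^ n)) *
        ∫⁻ x in W, ‖fderiv ℝ w x‖ₑ ^ p := by
  set h : E n → ℝ≥0∞ := fun x => ‖fderiv ℝ w x‖ₑ ^ p with hh
  have hhm : Measurable h :=
    (hw.continuous_fderiv one_ne_zero).enorm.measurable.pow_const p
  have hLe : ∀ x ∈ S, ∀ y ∈ D, ‖y - x‖ₑ ^ p ≤ ENNReal.ofReal L ^ p := fun x hx y hy => by
    rw [← ofReal_norm]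
    exact ENNReal.rpow_le_rpow (ENNReal.ofReal_le_ofReal (hL x hx y hy)) (by linarith)
  set Kc : ℝ≥0∞ := (volume S + volume D) * (2 ^ n) * ∫⁻ x in W, h x with hKc
  -- the bound for a fixed position on the segments
  have ht : ∀ t ∈ Ioc (0 : ℝ) 1, ∫⁻ x in S, ∫⁻ y in D, h (x + t • (y - x)) ≤ Kc := by
    intro t htm
    -- The point on the segment is (1 - t)x + ty. The change of variables is made in whichever of x
    -- and y has coefficient at least 1/2, avoiding a singular Jacobian at the ends.
    rcases le_total t 2⁻¹ with h1 | h1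
    · have htm' : Measurable fun z : E n × E n => h (z.1 + t • (z.2 - z.1)) :=
        hhm.comp (by fun_prop)
      rw [lintegral_lintegral_swap (Measurable.aemeasurable htm')]
      calc ∫⁻ y in D, ∫⁻ x in S, h (x + t • (y - x))
          ≤ ∫⁻ _ in D, 2 ^ n * ∫⁻ x in W, h x := by
            refine setLIntegral_mono measurable_const fun y hy => ?_
            have e : ∀ x, x + t • (y - x) = (1 - t) • x + t • y := fun x => by module
            simp only [e]
            refine setLIntegral_comp_affine_le hhm hW (by linarith) _ fun x hx => ?_
            rw [← e]
            exact hseg x hx y hy t htm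
        _ ≤ Kc := by
            rw [setLIntegral_const, mul_comm, hKc, ← mul_assoc]
            gcongr
            exact le_add_self
    · calc ∫⁻ x in S, ∫⁻ y in D, h (x + t • (y - x))
          ≤ ∫⁻ _ in S, 2 ^ n * ∫⁻ x in W, h x := by
            refine setLIntegral_mono measurable_const fun x hx => ?_
            have e : ∀ y, x + t • (y - x) = t • y + (1 - t) • x := fun y => by module
            simp only [e]
            refine setLIntegral_comp_affine_le hhm hW h1 _ fun y hy => ?_
            rw [← e]
            exact hseg x hx y hy t htm
        _ ≤ Kc := by
            rw [setLIntegral_const, mul_comm, hKc, ← mul_assoc]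
            gcongr
            exact le_self_add
  have hjoint : Measurable fun z : (E n × ℝ) × E n => h (z.1.1 + z.1.2 • (z.2 - z.1.1)) :=
    hhm.comp (by fun_prop)
  calc ∫⁻ x in S, ∫⁻ y in D, ‖w y - w x‖ₑ ^ p
      ≤ ∫⁻ x in S, ∫⁻ y in D, ENNReal.ofReal L ^ p *
          ∫⁻ t in Ioc (0 : ℝ) 1, h (x + t • (y - x)) := by
        refine lintegral_mono_ae ((ae_restrict_iff' hS).2 (ae_of_all _ fun x hx => ?_))
        refine lintegral_mono_ae ((ae_restrict_iff' hD).2 (ae_of_all _ fun y hy => ?_))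
        exact (enorm_sub_rpow_le hp hw x y).trans (mul_le_mul_left (hLe x hx y hy) _)
    _ = ∫⁻ x in S, ENNReal.ofReal L ^ p *
          ∫⁻ t in Ioc (0 : ℝ) 1, ∫⁻ y in D, h (x + t • (y - x)) := by
        refine lintegral_congr fun x => ?_
        have hxm : Measurable fun z : E n × ℝ => h (x + z.2 • (z.1 - x)) := hhm.comp (by fun_prop)
        rw [lintegral_const_mul _ (hxm.lintegral_prod_right' (ν := volume.restrict (Ioc 0 1))),
          lintegral_lintegral_swap (Measurable.aemeasurable hxm)]
    _ = ENNReal.ofReal L ^ p *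
          ∫⁻ t in Ioc (0 : ℝ) 1, ∫⁻ x in S, ∫⁻ y in D, h (x + t • (y - x)) := by
        have hm2 : Measurable fun z : E n × ℝ => ∫⁻ y in D, h (z.1 + z.2 • (y - z.1)) :=
          hjoint.lintegral_prod_right' (ν := volume.restrict D)
        rw [lintegral_const_mul _ (hm2.lintegral_prod_right' (ν := volume.restrict (Ioc 0 1))),
          lintegral_lintegral_swap (Measurable.aemeasurable hm2)]
    _ ≤ ENNReal.ofReal L ^ p * ∫⁻ _ in Ioc (0 : ℝ) 1, Kc := by
        gcongr 1
        exact setLIntegral_mono measurable_const ht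
    _ = _ := by simp [hKc, mul_assoc]

/-- The `L^p(S)` norm of the functions in `C¹_c(Ω)` is controlled by the `L^p(W)` norm of their
gradient. -/
def IsControlled (p : ℝ) (Ω W S : Set (E n)) : Prop :=
  ∃ C : NNReal, ∀ φ : E n → ℝ, ContDiff ℝ 1 φ → tsupport φ ⊆ Ω →
    ∫⁻ x in S, ‖φ x‖ₑ ^ p ≤ C * ∫⁻ x in W, ‖fderiv ℝ φ x‖ₑ ^ p

namespace IsControlled

variable {p : ℝ} {Ω W S T : Set (E n)}

theorem mono (h : IsControlled p Ω W T) (hST : S ⊆ T) : IsControlled p Ω W S :=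
  let ⟨C, hC⟩ := h
  ⟨C, fun φ hφ hs => (lintegral_mono_set hST).trans (hC φ hφ hs)⟩

theorem union (hS : IsControlled p Ω W S) (hT : IsControlled p Ω W T) :
    IsControlled p Ω W (S ∪ T) := by
  obtain ⟨C, hC⟩ := hS
  obtain ⟨C', hC'⟩ := hT
  refine ⟨C + C', fun φ hφ hs => (lintegral_union_le _ _ _).trans ?_⟩
  rw [ENNReal.coe_add, add_mul]
  exact add_le_add (hC φ hφ hs) (hC' φ hφ hs)

/-- The start of the chain: outside Ω the test functions vanish. -/
theorem of_disjoint (hp : 0 < p) (hS : MeasurableSet S) (h : Disjoint S Ω) :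
    IsControlled p Ω W S := by
  refine ⟨0, fun φ _ hs => ?_⟩
  rw [setLIntegral_congr_fun (g := fun _ => 0) hS fun x hx => ?_]
  · simp
  · simp only
    rw [image_eq_zero_of_notMem_tsupport fun h' => h.notMem_of_mem_left hx (hs h'), enorm_zero,
      ENNReal.zero_rpow_of_pos hp]

/-- The propagation step: average |φ(x)|^p ≤ 2^(p-1)(|φ(y) - φ(x)|^p + |φ(y)|^p) over y in `T`. The
difference is controlled along the segments, the other term by the hypothesis on `T`. -/
theorem of_segments (hp : 1 ≤ p) (hD : IsControlled p Ω W T) (hT0 : volume T ≠ 0)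
    (hW : MeasurableSet W) (hS : MeasurableSet S) (hT : MeasurableSet T)
    (hSb : Bornology.IsBounded S) (hTb : Bornology.IsBounded T)
    (hseg : ∀ x ∈ S, ∀ y ∈ T, ∀ t ∈ Ioc (0 : ℝ) 1, x + t • (y - x) ∈ W) :
    IsControlled p Ω W S := by
  obtain ⟨C, hC⟩ := hD
  obtain ⟨L, hL⟩ : ∃ L : ℝ, ∀ x ∈ S, ∀ y ∈ T, ‖y - x‖ ≤ L := by
    obtain ⟨R, hR⟩ := (hSb.union hTb).exists_norm_le
    exact ⟨R + R, fun x hx y hy =>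
      (norm_sub_le _ _).trans (add_le_add (hR y (Or.inr hy)) (hR x (Or.inl hx)))⟩
  have hTfin : volume T ≠ ⊤ := hTb.measure_lt_top.ne
  have hSfin : volume S ≠ ⊤ := hSb.measure_lt_top.ne
  set K : ℝ≥0∞ := ENNReal.ofReal L ^ p * ((volume S + volume T) * (2 ^ n)) with hK
  have hKfin : K ≠ ⊤ := by
    refine ENNReal.mul_ne_top (ENNReal.rpow_ne_top_of_nonneg (by linarith) ENNReal.ofReal_ne_top)
      (ENNReal.mul_ne_top (ENNReal.add_ne_top.2 ⟨hSfin, hTfin⟩) (by simp))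
  set C' : ℝ≥0∞ := (volume T)⁻¹ * (2 ^ (p - 1) * (K + C * volume S)) with hC'
  have hC'fin : C' ≠ ⊤ := by
    refine ENNReal.mul_ne_top (ENNReal.inv_ne_top.2 hT0) (ENNReal.mul_ne_top
      (ENNReal.rpow_ne_top_of_nonneg (by linarith) (by simp)) (ENNReal.add_ne_top.2 ⟨hKfin,
        ENNReal.mul_ne_top ENNReal.coe_ne_top hSfin⟩))
  refine ⟨C'.toNNReal, fun φ hφ hs => ?_⟩
  rw [ENNReal.coe_toNNReal hC'fin]
  set I := ∫⁻ x in W, ‖fderiv ℝ φ x‖ₑ ^ p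
  have hφm : Measurable fun x => ‖φ x‖ₑ ^ p := hφ.continuous.enorm.measurable.pow_const p
  have h1 := lintegral_lintegral_enorm_sub_rpow_le hp hW hS hT hseg hL hφ
  have h2 : ∀ x, volume T * ‖φ x‖ₑ ^ p ≤
      2 ^ (p - 1) * ((∫⁻ y in T, ‖φ y - φ x‖ₑ ^ p) + ∫⁻ y in T, ‖φ y‖ₑ ^ p) := fun x => by
    rw [← lintegral_add_right _ hφm, ← lintegral_const_mul' _ _
      (ENNReal.rpow_ne_top_of_nonneg (by linarith) (by simp)), mul_comm, ← setLIntegral_const]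
    refine lintegral_mono fun y => ?_
    refine le_trans ?_ (ENNReal.rpow_add_le_mul_rpow_add_rpow _ _ hp)
    refine ENNReal.rpow_le_rpow ?_ (by linarith)
    calc ‖φ x‖ₑ = ‖φ y - (φ y - φ x)‖ₑ := by rw [sub_sub_cancel]
      _ ≤ ‖φ y‖ₑ + ‖φ y - φ x‖ₑ := enorm_sub_le
      _ = _ := add_comm _ _
  have h3 : volume T * ∫⁻ x in S, ‖φ x‖ₑ ^ p ≤ 2 ^ (p - 1) * (K * I + C * I * volume S) := by
    rw [← lintegral_const_mul _ hφm]
    refine (lintegral_mono h2).trans ?_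
    rw [lintegral_const_mul' _ _ (ENNReal.rpow_ne_top_of_nonneg (by linarith) (by simp)),
      lintegral_add_right _ measurable_const, setLIntegral_const]
    gcongr
    exact hC φ hφ hs
  calc ∫⁻ x in S, ‖φ x‖ₑ ^ p = (volume T)⁻¹ * (volume T * ∫⁻ x in S, ‖φ x‖ₑ ^ p) := by
        rw [← mul_assoc, ENNReal.inv_mul_cancel hT0 hTfin, one_mul]
    _ ≤ (volume T)⁻¹ * (2 ^ (p - 1) * (K * I + C * I * volume S)) := by gcongr
    _ = C' * I := by rw [hC']; ring

end IsControlled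

/-! ### Lipschitz boundaries -/

/-- Translation along the unit vector `e` changes the component along `e` only. -/
theorem sub_inner_smul_add_smul {e : E n} (he : ‖e‖ = 1) (x : E n) (a : ℝ) :
    (x + a • e) - inner ℝ e (x + a • e) • e = x - inner ℝ e x • e ∧
      inner ℝ e (x + a • e) = inner ℝ e x + a := by
  have h : inner ℝ e (x + a • e) = inner ℝ e x + a := by
    rw [inner_add_right, inner_smul_right, real_inner_self_eq_norm_sq, he]; ring
  refine ⟨?_, h⟩
  rw [h]
  module

/-- The strict subgraph in the ball is open and disjoint from `U`. -/
theorem notMem_closure_of_lt {U : Set (E n)} {x₀ e : E n} {r : ℝ} {K : NNReal} {γ : E n → ℝ}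
    (hγ : LipschitzWith K γ)
    (h : ∀ x ∈ Metric.ball x₀ r, (x ∈ U ↔ γ (x - inner ℝ e x • e) < inner ℝ e x)) {x : E n}
    (hx : x ∈ Metric.ball x₀ r) (hlt : inner ℝ e x < γ (x - inner ℝ e x • e)) :
    x ∉ closure U := by
  have hc : Continuous fun x : E n => γ (x - inner ℝ e x • e) :=
    hγ.continuous.comp (by fun_prop)
  have hopen : IsOpen (Metric.ball x₀ r ∩ {x | inner ℝ e x < γ (x - inner ℝ e x • e)}) :=
    Metric.isOpen_ball.inter (isOpen_lt (by fun_prop) hc)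
  intro hcl
  obtain ⟨y, ⟨hy, hylt⟩, hyU⟩ := mem_closure_iff.1 hcl _ hopen ⟨hx, hlt⟩
  exact lt_asymm hylt ((h y hy).1 hyU)

theorem eq_of_mem_frontier {U : Set (E n)} (hU : IsOpen U) {x₀ e : E n} {r : ℝ} {K : NNReal}
    {γ : E n → ℝ} (hγ : LipschitzWith K γ)
    (h : ∀ x ∈ Metric.ball x₀ r, (x ∈ U ↔ γ (x - inner ℝ e x • e) < inner ℝ e x)) {x : E n}
    (hx : x ∈ Metric.ball x₀ r) (hf : x ∈ frontier U) :
    inner ℝ e x = γ (x - inner ℝ e x • e) := by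
  rw [hU.frontier_eq] at hf
  refine le_antisymm (not_lt.1 fun hlt => hf.2 ((h x hx).2 hlt)) (not_lt.1 fun hlt => ?_)
  exact notMem_closure_of_lt hγ h hx hlt hf.1

/-- Locally the frontier lies on a graph in the direction `e`. Its translates by the bounded
sequence of vectors e/(k+1) are pairwise disjoint, which is impossible for a set of positive
measure. -/
theorem HasLipschitzBoundary.volume_frontier {U : Set (E n)} (hU : IsOpen U)
    (h : HasLipschitzBoundary U) : volume (frontier U) = 0 := by
  refine measure_null_of_locally_null _ fun x₀ hx₀ => ?_
  obtain ⟨r, hr, e, he, K, γ, hγ, hx⟩ := h x₀ hx₀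
  refine ⟨frontier U ∩ Metric.ball x₀ r,
    inter_mem self_mem_nhdsWithin (mem_nhdsWithin_of_mem_nhds (Metric.ball_mem_nhds x₀ hr)), ?_⟩
  refine Measure.addHaar_eq_zero_of_disjoint_translates volume
    (fun k : ℕ => ((1 : ℝ) / (k + 1)) • e) ?_ ?_
    (isClosed_frontier.measurableSet.inter Metric.isOpen_ball.measurableSet)
  · refine (Metric.isBounded_closedBall (x := (0 : E n)) (r := 1)).subset ?_
    rintro _ ⟨k, rfl⟩
    rw [mem_closedBall_zero_iff, norm_smul, he, mul_one, Real.norm_eq_abs,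
      abs_of_pos (by positivity)]
    exact div_le_one_of_le₀ (by linarith [(Nat.cast_nonneg k : (0 : ℝ) ≤ k)]) (by positivity)
  · intro k l hkl
    refine Set.disjoint_left.2 fun z hz hz' => hkl ?_
    simp only [singleton_add, image_add_left, mem_preimage] at hz hz'
    have e₁ := eq_of_mem_frontier hU hγ hx hz.2 hz.1
    have e₂ := eq_of_mem_frontier hU hγ hx hz'.2 hz'.1
    have s₁ := sub_inner_smul_add_smul he z (-((1 : ℝ) / (k + 1)))
    have s₂ := sub_inner_smul_add_smul he z (-((1 : ℝ) / (l + 1)))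
    rw [← neg_smul, add_comm, s₁.1, s₁.2] at e₁
    rw [← neg_smul, add_comm, s₂.1, s₂.2] at e₂
    have : (1 : ℝ) / (k + 1) = 1 / (l + 1) := by linarith
    rw [one_div, one_div, inv_inj] at this
    exact_mod_cast (add_right_cancel this)

/-- The exterior of a Lipschitz set is, near a boundary point, star-shaped with respect to a small
ball. -/
theorem exists_segments_of_mem_frontier {U : Set (E n)} (hU : IsOpen U) {x₀ e : E n} {r : ℝ}
    (hr : 0 < r) (he : ‖e‖ = 1) {K : NNReal} {γ : E n → ℝ} (hγ : LipschitzWith K γ)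
    (h : ∀ x ∈ Metric.ball x₀ r, (x ∈ U ↔ γ (x - inner ℝ e x • e) < inner ℝ e x))
    (hx₀ : x₀ ∈ frontier U) :
    ∃ y₀ ∈ Metric.ball x₀ r, y₀ ∉ closure U ∧ ∃ δ₀ > 0, ∀ δ ≤ δ₀,
      ∀ x ∈ Metric.ball x₀ δ \ closure U, ∀ y ∈ Metric.ball y₀ δ, ∀ t ∈ Ioc (0 : ℝ) 1,
        x + t • (y - x) ∈ (closure U)ᶜ := by
  have hK : (0 : ℝ) ≤ K := K.2
  have hpi := sub_inner_smul_add_smul he x₀ (-(r / 2))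
  have hy₀ : x₀ + (-(r / 2)) • e ∈ Metric.ball x₀ r := by
    rw [Metric.mem_ball, dist_eq_norm, add_sub_cancel_left, norm_smul, he, mul_one, Real.norm_eq_abs,
      abs_neg, abs_of_pos (by positivity)]
    linarith
  have heq := eq_of_mem_frontier hU hγ h (Metric.mem_ball_self hr) hx₀
  -- The ball is centred at depth r/2 below the graph. Moving a fraction t of the way toward it
  -- lowers the height by at least t(r/2 - 2δ), while the graph drops by at most 4Kδt. The bound on
  -- δ gives 2δ + 4Kδ < r/2, so the segment stays strictly below.
  refine ⟨x₀ + (-(r / 2)) • e, hy₀, notMem_closure_of_lt hγ h hy₀ ?_,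
    r / 2 / (4 * (2 * K + 1)), by positivity, fun δ hδ x hx y hy t ht => ?_⟩
  · rw [hpi.1, hpi.2, ← heq]; linarith
  · have hδ' : δ * (4 * (2 * K + 1)) ≤ r / 2 := (le_div_iff₀ (by positivity)).1 hδ
    have hxn : ‖x - x₀‖ < δ := by simpa [dist_eq_norm] using hx.1
    have hδ0 : 0 < δ := (norm_nonneg _).trans_lt hxn
    have hδr : 4 * δ ≤ r / 2 := by nlinarith
    set v : E n := (y - (x₀ + (-(r / 2)) • e)) - (x - x₀) with hv
    have hvn : ‖v‖ ≤ 2 * δ := by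
      have : ‖y - (x₀ + (-(r / 2)) • e)‖ < δ := by simpa [dist_eq_norm] using hy
      exact (norm_sub_le _ _).trans (by linarith)
    have hyx : y - x = v + (-(r / 2)) • e := by rw [hv]; module
    have hve : |inner ℝ e v| ≤ 2 * δ :=
      (abs_real_inner_le_norm e v).trans (by rw [he, one_mul]; exact hvn)
    have hxr : x ∈ Metric.ball x₀ r := Metric.ball_subset_ball (by linarith) hx.1
    have hyr : y ∈ Metric.ball x₀ r := by
      rw [Metric.mem_ball, dist_eq_norm]
      have : y - x₀ = (y - (x₀ + (-(r / 2)) • e)) + (-(r / 2)) • e := by module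
      rw [this]
      refine (norm_add_le _ _).trans_lt ?_
      have h1 : ‖y - (x₀ + (-(r / 2)) • e)‖ < δ := by simpa [dist_eq_norm] using hy
      rw [norm_smul, he, mul_one, Real.norm_eq_abs, abs_neg, abs_of_pos (by positivity)]
      linarith
    have hz : x + t • (y - x) ∈ Metric.ball x₀ r :=
      (convex_ball x₀ r).add_smul_sub_mem hxr hyr ⟨ht.1.le, ht.2⟩
    refine notMem_closure_of_lt hγ h hz ?_
    have hxle : inner ℝ e x ≤ γ (x - inner ℝ e x • e) :=
      not_lt.1 fun hlt => hx.2 (subset_closure ((h x hxr).2 hlt))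
    have hz1 : inner ℝ e (x + t • (y - x)) = inner ℝ e x + t * (inner ℝ e v - r / 2) := by
      rw [inner_add_right, inner_smul_right, hyx, (sub_inner_smul_add_smul he v _).2]; ring
    have hz2 : (x + t • (y - x)) - inner ℝ e (x + t • (y - x)) • e =
        (x - inner ℝ e x • e) + t • (v - inner ℝ e v • e) := by
      rw [hz1, hyx]; module
    have hlip := hγ.dist_le_mul ((x - inner ℝ e x • e) + t • (v - inner ℝ e v • e))
      (x - inner ℝ e x • e)
    rw [Real.dist_eq, dist_eq_norm, add_sub_cancel_left, norm_smul, Real.norm_eq_abs,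
      abs_of_pos ht.1] at hlip
    have hpn : ‖v - inner ℝ e v • e‖ ≤ 4 * δ := by
      refine (norm_sub_le _ _).trans ?_
      rw [norm_smul, he, mul_one, Real.norm_eq_abs]
      linarith
    rw [hz2, hz1]
    have h1 := neg_abs_le (γ ((x - inner ℝ e x • e) + t • (v - inner ℝ e v • e)) -
      γ (x - inner ℝ e x • e))
    have h2 : (K : ℝ) * (t * ‖v - inner ℝ e v • e‖) ≤ t * (4 * (K * δ)) := by
      have := mul_le_mul_of_nonneg_left hpn (mul_nonneg hK ht.1.le)
      nlinarith
    have h3 : t * (inner ℝ e v - r / 2) < t * (-(4 * (K * δ))) := by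
      refine mul_lt_mul_of_pos_left ?_ ht.1
      have := (abs_le.1 hve).2
      nlinarith
    nlinarith

/-- The Poincaré inequality on `Ω \ closure A` for functions vanishing near `∂Ω`. -/
theorem IsTwoPhaseDomain.isControlled (hn : n ≠ 0) {p : ℝ} (hp : 1 ≤ p) {Ω A : Set (E n)}
    (h : IsTwoPhaseDomain Ω A) : IsControlled p Ω (closure A)ᶜ (outerPhase Ω A) := by
  have hne : Nonempty (Fin n) := ⟨⟨0, Nat.pos_of_ne_zero hn⟩⟩
  -- Gradients are integrated over the complement of the closure of A, not only over B, so that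
  -- segments may leave Ω; the test functions vanish there.
  set W : Set (E n) := (closure A)ᶜ with hWdef
  set B := outerPhase Ω A with hB
  have hWo : IsOpen W := isClosed_closure.isOpen_compl
  have hBW : B ⊆ W := fun x hx => hx.2
  have hball : ∀ (y : E n) {δ : ℝ}, 0 < δ → volume (Metric.ball y δ) ≠ 0 := fun y δ hδ =>
    (Metric.isOpen_ball.measure_pos volume ⟨y, Metric.mem_ball_self hδ⟩).ne'
  let G : Set (E n) := {x | ∃ r > 0, IsControlled p Ω W (Metric.ball x r)}
  have hGo : IsOpen G := by
    refine Metric.isOpen_iff.2 fun x ⟨r, hr, hx⟩ => ⟨r / 2, by positivity, fun y hy => ?_⟩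
    refine ⟨r / 2, by positivity, hx.mono (Metric.ball_subset_ball' ?_)⟩
    have := Metric.mem_ball.1 hy
    linarith
  -- By convexity, a ball in `W` is joined by segments inside it to a small controlled ball around
  -- any of its points in `G`.
  have hstep : ∀ (x : E n) (r : ℝ), Metric.ball x r ⊆ W → (Metric.ball x r ∩ G).Nonempty →
      IsControlled p Ω W (Metric.ball x r) := by
    rintro x r hxr ⟨z, hz, δ, hδ, hzc⟩
    obtain ⟨δ', hδ', hsub⟩ := Metric.isOpen_iff.1 Metric.isOpen_ball z hz
    refine IsControlled.of_segments hp
      (hzc.mono (Metric.ball_subset_ball (min_le_left δ δ')))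
      (hball z (lt_min hδ hδ')) hWo.measurableSet measurableSet_ball measurableSet_ball
      Metric.isBounded_ball Metric.isBounded_ball fun a ha b hb t ht => hxr ?_
    exact (convex_ball x r).add_smul_sub_mem ha
      (hsub (Metric.ball_subset_ball (min_le_right δ δ') hb)) ⟨ht.1.le, ht.2⟩
  -- points of `B` near the outer boundary
  have hstart : (B ∩ G).Nonempty := by
    have hΩ : Ω ≠ univ := fun hu =>
      NormedSpace.unbounded_univ ℝ (E n) (hu ▸ h.isBounded)
    obtain ⟨x₀, hx₀⟩ := nonempty_frontier_iff.2 ⟨h.isConnected.nonempty, hΩ⟩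
    have hx₀' := hx₀
    rw [h.isOpen.frontier_eq] at hx₀'
    have hx₀W : x₀ ∈ W := fun hc => hx₀'.2 (h.closure_inner_subset hc)
    obtain ⟨r₁, hr₁, hsub⟩ := Metric.isOpen_iff.1 hWo x₀ hx₀W
    obtain ⟨r, hr, e, he, K, γ, hγ, hx⟩ := h.lipschitz x₀ hx₀
    obtain ⟨y₀, hy₀, hy₀c, -⟩ := exists_segments_of_mem_frontier h.isOpen (lt_min hr hr₁) he hγ
      (fun x hxm => hx x (Metric.ball_subset_ball (min_le_left _ _) hxm)) hx₀
    -- The Lipschitz condition yields points outside the closure of Ω arbitrarily near ∂Ω; a small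
    -- ball around such a point is trivially controlled.
    have hy₀G : y₀ ∈ G := by
      obtain ⟨δ, hδ, hd⟩ := Metric.isOpen_iff.1 (isClosed_closure (s := Ω)).isOpen_compl y₀ hy₀c
      exact ⟨δ, hδ, IsControlled.of_disjoint (by linarith) measurableSet_ball
        (Set.disjoint_left.2 fun x hx hxΩ => hd hx (subset_closure hxΩ))⟩
    have hc := hstep x₀ r₁ hsub ⟨y₀, Metric.ball_subset_ball (min_le_right _ _) hy₀, hy₀G⟩
    obtain ⟨z, hz, hzΩ⟩ := mem_closure_iff.1 hx₀'.1 _ Metric.isOpen_ball (Metric.mem_ball_self hr₁)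
    refine ⟨z, ⟨hzΩ, hsub hz⟩, ?_⟩
    obtain ⟨δ, hδ, hd⟩ := Metric.isOpen_iff.1 Metric.isOpen_ball z hz
    exact ⟨δ, hδ, hc.mono hd⟩
  -- `G` is open, meets `B`, and is relatively closed in `B` by `hstep`, so the connected set `B`
  -- lies in it.
  have hBG : B ⊆ G := by
    refine h.isConnected_outer.isPreconnected.subset_of_closure_inter_subset hGo hstart ?_
    rintro x ⟨hxG, hxB⟩
    obtain ⟨r, hr, hsub⟩ := Metric.isOpen_iff.1 hWo x (hBW hxB)
    exact ⟨r, hr, hstep x r hsub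
      (mem_closure_iff.1 hxG _ Metric.isOpen_ball (Metric.mem_ball_self hr))⟩
  -- Control is needed up to the boundary. At a point of ∂A the local star-shapedness of the
  -- exterior reaches a ball in the interior of B; at any other point a whole ball lies in `W` and
  -- `hstep` applies.
  have hloc : ∀ x ∈ closure B, ∃ δ > 0, IsControlled p Ω W (Metric.ball x δ ∩ B) := by
    intro x hx
    by_cases hxA : x ∈ closure A
    · have hxf : x ∈ frontier A := by
        rw [h.isOpen_inner.frontier_eq]
        refine ⟨hxA, fun hxA' => ?_⟩
        obtain ⟨z, hzA, hzB⟩ := mem_closure_iff.1 hx _ h.isOpen_inner hxA'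
        exact hzB.2 (subset_closure hzA)
      obtain ⟨r₁, hr₁, hsub⟩ := Metric.isOpen_iff.1 h.isOpen x (h.closure_inner_subset hxA)
      obtain ⟨r, hr, e, he, K, γ, hγ, hlip⟩ := h.lipschitz_inner x hxf
      obtain ⟨y₀, hy₀, hy₀c, δ₀, hδ₀, hseg⟩ :=
        exists_segments_of_mem_frontier h.isOpen_inner (lt_min hr hr₁) he hγ
        (fun x hxm => hlip x (Metric.ball_subset_ball (min_le_left _ _) hxm)) hxf
      obtain ⟨δ₁, hδ₁, hc⟩ :=
        hBG ⟨hsub (Metric.ball_subset_ball (min_le_right _ _) hy₀), hy₀c⟩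
      have hδ := lt_min hδ₀ hδ₁
      refine ⟨min δ₀ δ₁, hδ, IsControlled.mono (T := Metric.ball x (min δ₀ δ₁) \ closure A) ?_
        fun z hz => ⟨hz.1, hz.2.2⟩⟩
      exact IsControlled.of_segments hp
        (hc.mono (Metric.ball_subset_ball (min_le_right δ₀ δ₁))) (hball y₀ hδ) hWo.measurableSet
        (measurableSet_ball.diff isClosed_closure.measurableSet) measurableSet_ball
        (Metric.isBounded_ball.subset sdiff_subset) Metric.isBounded_ball
        (hseg _ (min_le_left _ _))
    · obtain ⟨r, hr, hsub⟩ := Metric.isOpen_iff.1 hWo x hxA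
      obtain ⟨z, hz, hzB⟩ := mem_closure_iff.1 hx _ Metric.isOpen_ball (Metric.mem_ball_self hr)
      exact ⟨r, hr, (hstep x r hsub ⟨z, hz, hBG hzB⟩).mono inter_subset_left⟩
  have hcomp : IsCompact (closure B) := (h.isBounded.subset sdiff_subset).isCompact_closure
  have := hcomp.induction_on (p := fun s => IsControlled p Ω W (s ∩ B))
    (by rw [empty_inter]; exact ⟨0, fun φ _ _ => by simp⟩)
    (fun s t hst ht => ht.mono (inter_subset_inter_left _ hst))
    (fun s t hs ht => by rw [union_inter_distrib_right]; exact hs.union ht)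
    (fun x hx => by
      obtain ⟨δ, hδ, hc⟩ := hloc x hx
      exact ⟨_, mem_nhdsWithin_of_mem_nhds (Metric.ball_mem_nhds x hδ), hc⟩)
  exact this.mono fun x hx => ⟨subset_closure hx, hx⟩

end Poincare

/-! ### Functions vanishing on ∂Ω, and the Poincaré inequality for them. -/

section Closure

variable {n : ℕ} {U Ω : Set (E n)} {p : ℝ} {u w : E n → ℝ}

theorem MemW.sobolevNorm_add_le (hU : IsOpen U) (hp : 1 ≤ p) (h₁ : MemW p U u) (h₂ : MemW p U w) :
    sobolevNorm p U (u + w) ≤ sobolevNorm p U u + sobolevNorm p U w := by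
  have hp' : 1 ≤ ENNReal.ofReal p := by simpa using hp
  rw [sobolevNorm, eLpNorm_congr_ae (h₁.weakGradient_add hU h₂), sobolevNorm, sobolevNorm,
    add_add_add_comm]
  exact add_le_add (eLpNorm_add_le h₁.1.1 h₂.1.1 hp')
    (eLpNorm_add_le (h₁.memLp_weakGradient hU).1 (h₂.memLp_weakGradient hU).1 hp')

theorem MemW.sobolevNorm_const_smul (hU : IsOpen U) (h : MemW p U u) (c : ℝ) :
    sobolevNorm p U (c • u) = ‖c‖ₑ * sobolevNorm p U u := by
  rw [sobolevNorm, eLpNorm_congr_ae (h.weakGradient_const_smul hU c), eLpNorm_const_smul,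
    eLpNorm_const_smul, sobolevNorm, mul_add]

theorem MemWZeroOn.of_forall_exists (hU : IsOpen U) (hb : Bornology.IsBounded U) (hp : 1 ≤ p)
    (hw : MemW p U w)
    (h : ∀ ε : ℝ≥0∞, 0 < ε → ∃ w', MemWZeroOn p Ω U w' ∧ sobolevNorm p U (w - w') < ε) :
    MemWZeroOn p Ω U w := by
  refine ⟨hw, fun ε hε => ?_⟩
  have hε2 : 0 < ε / 2 := ENNReal.half_pos hε.ne'
  obtain ⟨w', hw', hlt⟩ := h (ε / 2) hε2
  obtain ⟨φ, hφ, hc, hs, hlt'⟩ := hw'.2 (ε / 2) hε2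
  refine ⟨φ, hφ, hc, hs, ?_⟩
  rw [← sub_add_sub_cancel w w' φ]
  refine (MemW.sobolevNorm_add_le hU hp (hw.sub hU hw'.1)
    (hw'.1.sub hU (MemW.of_contDiff hb hφ))).trans_lt ?_
  rw [← ENNReal.add_halves ε]
  exact ENNReal.add_lt_add hlt hlt'

theorem MemWZeroOn.add (hU : IsOpen U) (hb : Bornology.IsBounded U) (hp : 1 ≤ p)
    (h₁ : MemWZeroOn p Ω U u) (h₂ : MemWZeroOn p Ω U w) : MemWZeroOn p Ω U (u + w) := by
  refine ⟨h₁.1.add hU h₂.1, fun ε hε => ?_⟩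
  have hε2 : 0 < ε / 2 := ENNReal.half_pos hε.ne'
  obtain ⟨φ, hφ, hc, hs, hlt⟩ := h₁.2 (ε / 2) hε2
  obtain ⟨ψ, hψ, hc', hs', hlt'⟩ := h₂.2 (ε / 2) hε2
  refine ⟨φ + ψ, hφ.add hψ, hc.add hc', (tsupport_add φ ψ).trans (union_subset hs hs'), ?_⟩
  rw [add_sub_add_comm]
  refine (MemW.sobolevNorm_add_le hU hp (h₁.1.sub hU (MemW.of_contDiff hb hφ))
    (h₂.1.sub hU (MemW.of_contDiff hb hψ))).trans_lt ?_
  rw [← ENNReal.add_halves ε]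
  exact ENNReal.add_lt_add hlt hlt'

theorem MemWZeroOn.const_smul (hU : IsOpen U) (hb : Bornology.IsBounded U)
    (h : MemWZeroOn p Ω U u) (c : ℝ) : MemWZeroOn p Ω U (c • u) := by
  refine ⟨h.1.const_smul hU c, fun ε hε => ?_⟩
  obtain ⟨φ, hφ, hc, hs, hlt⟩ := h.2 (ε / (‖c‖ₑ + 1)) (ENNReal.div_pos hε.ne' (by simp))
  refine ⟨c • φ, hφ.const_smul c, hc.smul_left, ?_, ?_⟩
  · exact (closure_mono (Function.support_const_smul_subset c φ)).trans hs
  · rw [← smul_sub, MemW.sobolevNorm_const_smul hU (h.1.sub hU (MemW.of_contDiff hb hφ))]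
    rw [ENNReal.lt_div_iff_mul_lt (by simp) (by simp)] at hlt
    refine lt_of_le_of_lt ?_ hlt
    rw [mul_comm]
    gcongr
    exact le_self_add

theorem MemWZeroOn.sub (hU : IsOpen U) (hb : Bornology.IsBounded U) (hp : 1 ≤ p)
    (h₁ : MemWZeroOn p Ω U u) (h₂ : MemWZeroOn p Ω U w) : MemWZeroOn p Ω U (u - w) := by
  have := h₁.add hU hb hp (h₂.const_smul hU hb (-1))
  simpa [sub_eq_add_neg] using this

/-- On a bounded set Hölder's inequality bounds the `r`-norm by the `p`-norm, so the same
approximating functions serve. -/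
theorem MemWZeroOn.mono_exponent (hU : IsOpen U) (hb : Bornology.IsBounded U) {r : ℝ} (hr : 0 < r)
    (hrp : r ≤ p) (h : MemWZeroOn p Ω U w) : MemWZeroOn r Ω U w := by
  have hfin : IsFiniteMeasure (volume.restrict U) := ⟨by simpa using hb.measure_lt_top⟩
  refine ⟨h.1.mono_exponent hU hrp, fun ε hε => ?_⟩
  set c : ℝ≥0∞ := (volume.restrict U) univ ^
    (1 / (ENNReal.ofReal r).toReal - 1 / (ENNReal.ofReal p).toReal) with hc
  have hcfin : c ≠ ⊤ := by
    refine ENNReal.rpow_ne_top_of_nonneg ?_ (measure_ne_top _ _)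
    rw [ENNReal.toReal_ofReal hr.le, ENNReal.toReal_ofReal (hr.le.trans hrp), sub_nonneg]
    exact one_div_le_one_div_of_le hr hrp
  obtain ⟨φ, hφ, hcs, hs, hlt⟩ := h.2 (ε / (c + 1)) (ENNReal.div_pos hε.ne' (by simp [hcfin]))
  refine ⟨φ, hφ, hcs, hs, ?_⟩
  have hm := h.1.sub hU (MemW.of_contDiff hb hφ)
  rw [ENNReal.lt_div_iff_mul_lt (by simp) (by simp [hcfin])] at hlt
  refine lt_of_le_of_lt ?_ hlt
  refine le_trans ?_ (mul_le_mul' le_rfl (le_self_add (a := c) (b := 1)))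
  rw [sobolevNorm, sobolevNorm, add_mul]
  exact add_le_add
    (eLpNorm_le_eLpNorm_mul_rpow_measure_univ (ENNReal.ofReal_le_ofReal hrp) hm.1.1)
    (eLpNorm_le_eLpNorm_mul_rpow_measure_univ (ENNReal.ofReal_le_ofReal hrp)
      (hm.memLp_weakGradient hU).1)

/-- The Poincaré inequality on `U` for functions in `C¹_c(Ω)`. -/
def HasPoincare (p : ℝ) (Ω U : Set (E n)) : Prop :=
  ∃ C : NNReal, ∀ φ : E n → ℝ, ContDiff ℝ 1 φ → tsupport φ ⊆ Ω →
    eLpNorm φ (ENNReal.ofReal p) (volume.restrict U) ≤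
      C * eLpNorm (gradient φ) (ENNReal.ofReal p) (volume.restrict U)

theorem eLpNorm_rpow_eq_lintegral {α F : Type*} [MeasurableSpace α] {μ : Measure α}
    [NormedAddCommGroup F] (hp : 0 < p) (g : α → F) :
    eLpNorm g (ENNReal.ofReal p) μ ^ p = ∫⁻ x, ‖g x‖ₑ ^ p ∂μ := by
  rw [eLpNorm_eq_lintegral_rpow_enorm_toReal (by simpa using hp) ENNReal.ofReal_ne_top,
    ENNReal.toReal_ofReal hp.le, ← ENNReal.rpow_mul, one_div_mul_cancel hp.ne', ENNReal.rpow_one]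

/-- The gradient of a test function vanishes outside Ω, so integrating it over the complement of the
closure of A amounts to integrating over B. -/
theorem IsTwoPhaseDomain.hasPoincare (hn : n ≠ 0) (hp : 1 ≤ p) {A : Set (E n)}
    (h : IsTwoPhaseDomain Ω A) : HasPoincare p Ω (outerPhase Ω A) := by
  have hp0 : 0 < p := by linarith
  obtain ⟨C, hC⟩ := h.isControlled hn hp
  refine ⟨(C ^ (1 / p)), fun φ hφ hs => ?_⟩
  rw [← ENNReal.rpow_le_rpow_iff hp0, ENNReal.mul_rpow_of_nonneg _ _ hp0.le,
    eLpNorm_rpow_eq_lintegral hp0, eLpNorm_rpow_eq_lintegral hp0]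
  have hz : ∀ x ∈ (closure A)ᶜ \ outerPhase Ω A, ‖fderiv ℝ φ x‖ₑ ^ p = 0 := fun x hx => by
    have hxΩ : x ∉ Ω := fun hxΩ => hx.2 ⟨hxΩ, hx.1⟩
    have h0 : fderiv ℝ φ x = 0 := image_eq_zero_of_notMem_tsupport
      fun h' => hxΩ (hs (tsupport_fderiv_subset ℝ h'))
    rw [← ofReal_norm, h0, norm_zero, ENNReal.ofReal_zero, ENNReal.zero_rpow_of_pos hp0]
  have hsub : outerPhase Ω A ⊆ (closure A)ᶜ := fun x hx => hx.2
  have heq : ∫⁻ x in (closure A)ᶜ, ‖fderiv ℝ φ x‖ₑ ^ p =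
      ∫⁻ x in outerPhase Ω A, ‖gradient φ x‖ₑ ^ p := by
    have hB : MeasurableSet (outerPhase Ω A) :=
      (h.isOpen.sdiff isClosed_closure).measurableSet
    rw [← lintegral_indicator isClosed_closure.measurableSet.compl, ← lintegral_indicator hB]
    refine lintegral_congr fun x => ?_
    by_cases hx : x ∈ outerPhase Ω A
    · rw [indicator_of_mem hx, indicator_of_mem (hsub hx), gradient,
        ← ofReal_norm ((InnerProductSpace.toDual ℝ (E n)).symm _), LinearIsometryEquiv.norm_map,
        ofReal_norm]
    · rw [indicator_of_notMem hx]
      by_cases hx' : x ∈ (closure A)ᶜ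
      · rw [indicator_of_mem hx', hz x ⟨hx', hx⟩]
      · rw [indicator_of_notMem hx']
  rw [← heq, ENNReal.coe_rpow_of_nonneg _ (by positivity), ← ENNReal.rpow_mul,
    one_div_mul_cancel hp0.ne', ENNReal.rpow_one]
  exact hC φ hφ hs

theorem HasPoincare.eLpNorm_le (hU : IsOpen U) (hb : Bornology.IsBounded U) (hp : 1 ≤ p)
    (h : HasPoincare p Ω U) :
    ∃ C : NNReal, ∀ w, MemWZeroOn p Ω U w → eLpNorm w (ENNReal.ofReal p) (volume.restrict U) ≤
      C * eLpNorm (weakGradient U w) (ENNReal.ofReal p) (volume.restrict U) := by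
  have hp' : 1 ≤ ENNReal.ofReal p := by simpa using hp
  obtain ⟨C, hC⟩ := h
  refine ⟨C, fun w hw => ENNReal.le_of_forall_pos_le_add fun ε hε _ => ?_⟩
  -- Replacing `w` by `φ` costs `a` on the left and `C * b` on the right, together at most `(1 + C)
  -- * (a + b)`.
  have hε' : (0 : ℝ≥0∞) < ε / (1 + C) :=
    ENNReal.div_pos (by simpa using hε.ne') (by simp)
  obtain ⟨φ, hφ, hc, hs, hlt⟩ := hw.2 _ hε'
  have hφW : MemW p U φ := MemW.of_contDiff hb hφ
  have hm := hw.1.sub hU hφW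
  rw [sobolevNorm] at hlt
  set a := eLpNorm (w - φ) (ENNReal.ofReal p) (volume.restrict U)
  set b := eLpNorm (weakGradient U (w - φ)) (ENNReal.ofReal p) (volume.restrict U) with hbdef
  have h1 : eLpNorm w (ENNReal.ofReal p) (volume.restrict U) ≤
      a + eLpNorm φ (ENNReal.ofReal p) (volume.restrict U) := by
    have := eLpNorm_add_le (hw.1.1.sub hφW.1).1 hφW.1.1 hp'
    rwa [sub_add_cancel] at this
  have h2 : eLpNorm (gradient φ) (ENNReal.ofReal p) (volume.restrict U) ≤
      eLpNorm (weakGradient U w) (ENNReal.ofReal p) (volume.restrict U) + b := by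
    rw [← eLpNorm_congr_ae ((HasWeakGradient.of_contDiff hφ).weakGradient_ae_eq hU), hbdef,
      eLpNorm_congr_ae (hw.1.weakGradient_sub hU hφW)]
    have := eLpNorm_sub_le (hw.1.memLp_weakGradient hU).1
      ((hw.1.memLp_weakGradient hU).sub (hφW.memLp_weakGradient hU)).1 hp'
    rwa [sub_sub_cancel] at this
  calc eLpNorm w (ENNReal.ofReal p) (volume.restrict U)
      ≤ a + C * (eLpNorm (weakGradient U w) (ENNReal.ofReal p) (volume.restrict U) + b) :=
        h1.trans (add_le_add le_rfl ((hC φ hφ hs).trans (mul_le_mul' le_rfl h2)))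
    _ = C * eLpNorm (weakGradient U w) (ENNReal.ofReal p) (volume.restrict U) + (a + C * b) := by
        ring
    _ ≤ _ := by
        gcongr
        have h3 : (a + b) * (1 + C) < ε :=
          (ENNReal.lt_div_iff_mul_lt (by simp) (by simp)).1 hlt
        refine le_trans ?_ h3.le
        calc a + C * b ≤ (a + C * b) + (b + a * C) := le_self_add
          _ = _ := by ring

end Closure

/-! ### The direct method for uniformly convex energies. -/

section DirectMethod

variable {n : ℕ}

/-- Integrate the pointwise convexity estimate. The midpoint contributes at least `C * m` on the
left and the average energy at most `C * (m + δ)` on the right, so `C * m` cancels and only small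
terms remain. -/
theorem IsUniformlyConvexEnergy.lintegral_le {r : ℝ} {S : Set (E n)} {σ : E n → ℝ → EReal}
    (h : IsUniformlyConvexEnergy r S σ) (hS : volume S ≠ ⊤) {m : ℝ≥0∞} (hm : m ≠ ⊤) {η : NNReal}
    (hη : η ≠ 0) : ∃ δ : NNReal, δ ≠ 0 ∧ ∀ G₁ G₂ : E n → E n,
      AEMeasurable G₁ (volume.restrict S) → AEMeasurable G₂ (volume.restrict S) →
      m ≤ energyOn σ S ((2⁻¹ : ℝ) • (G₁ + G₂)) → energyOn σ S G₁ ≤ m + δ →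
      energyOn σ S G₂ ≤ m + δ → ∫⁻ x in S, ‖G₁ x - G₂ x‖ₑ ^ r ≤ η := by
  lift m to NNReal using hm
  obtain ⟨V, hV⟩ : ∃ V : NNReal, (V : ℝ≥0∞) = volume S := ⟨_, ENNReal.coe_toNNReal hS⟩
  -- As `δ ≤ 1`, the volume plus both energies is at most `V + 2 * m + 2`. This choice makes the
  -- ε-term at most η/2; then `δ` is taken with `C * δ ≤ η / 2`.
  set ε : NNReal := η / 2 / (V + 2 * m + 2) with hε
  have hε0 : ε ≠ 0 := by positivity
  obtain ⟨C, hC⟩ := h.uniform ε hε0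
  have hCx := hC C le_rfl
  refine ⟨min 1 (η / 2 / (C + 1)), (lt_min one_pos (by positivity)).ne',
    fun G₁ G₂ h₁ h₂ hmid hJ₁ hJ₂ => ?_⟩
  set δ : NNReal := min 1 (η / 2 / (C + 1)) with hδ
  have hm₁ := h.aemeasurable G₁ h₁
  have hm₂ := h.aemeasurable G₂ h₂
  have hmm := h.aemeasurable _ ((h₁.add h₂).const_smul (2⁻¹ : ℝ))
  have hint : (∫⁻ x in S, ‖G₁ x - G₂ x‖ₑ ^ r) + C * energyOn σ S ((2⁻¹ : ℝ) • (G₁ + G₂)) ≤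
      ε * (volume S + energyOn σ S G₁ + energyOn σ S G₂) +
        C * ((energyOn σ S G₁ + energyOn σ S G₂) / 2) := by
    have e1 : ∫⁻ x in S, (‖G₁ x - G₂ x‖ₑ ^ r +
        C * energyDensity σ x ‖((2⁻¹ : ℝ) • (G₁ + G₂)) x‖) =
        (∫⁻ x in S, ‖G₁ x - G₂ x‖ₑ ^ r) + C * energyOn σ S ((2⁻¹ : ℝ) • (G₁ + G₂)) := by
      rw [lintegral_add_right' _ (hmm.const_mul _), lintegral_const_mul'' _ hmm]
      rfl
    have e2 : ∫⁻ x in S, (ε * (1 + energyDensity σ x ‖G₁ x‖ + energyDensity σ x ‖G₂ x‖) +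
        C * ((energyDensity σ x ‖G₁ x‖ + energyDensity σ x ‖G₂ x‖) / 2)) =
        ε * (volume S + energyOn σ S G₁ + energyOn σ S G₂) +
        C * ((energyOn σ S G₁ + energyOn σ S G₂) / 2) := by
      have ha : AEMeasurable (fun x => energyDensity σ x ‖G₁ x‖ + energyDensity σ x ‖G₂ x‖)
        (volume.restrict S) := hm₁.add hm₂
      have ha₁ : AEMeasurable (fun x => 1 + energyDensity σ x ‖G₁ x‖ + energyDensity σ x ‖G₂ x‖)
        (volume.restrict S) := (aemeasurable_const.add hm₁).add hm₂
      simp only [div_eq_mul_inv]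
      rw [lintegral_add_right' _ ((ha.mul_const _).const_mul _), lintegral_const_mul'' _ ha₁,
        lintegral_add_right' _ hm₂, lintegral_add_right' _ hm₁,
        lintegral_const_mul'' _ (ha.mul_const _), lintegral_mul_const'' _ ha,
        lintegral_add_right' _ hm₂, setLIntegral_one]
      rfl
    rw [← e1, ← e2]
    refine lintegral_mono_ae ?_
    filter_upwards [hCx] with x hx
    exact hx (G₁ x) (G₂ x)
  have hδ1 : δ ≤ 1 := min_le_left _ _
  have hbound : (∫⁻ x in S, ‖G₁ x - G₂ x‖ₑ ^ r) + C * m ≤ (η : ℝ≥0∞) + C * m := by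
    calc (∫⁻ x in S, ‖G₁ x - G₂ x‖ₑ ^ r) + C * m
        ≤ ε * (volume S + energyOn σ S G₁ + energyOn σ S G₂) +
          C * ((energyOn σ S G₁ + energyOn σ S G₂) / 2) :=
          le_trans (by gcongr) hint
      _ ≤ ε * (volume S + (m + δ) + (m + δ)) + C * (((m + δ) + (m + δ)) / 2) := by gcongr
      _ ≤ ((η + C * m : NNReal) : ℝ≥0∞) := by
          rw [← hV, show ((m : ℝ≥0∞) + δ + (m + δ)) / 2 = m + δ by
            rw [← two_mul, mul_comm, ENNReal.mul_div_cancel_right (by simp) (by simp)]]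
          norm_cast
          have h1 : ε * (V + (m + δ) + (m + δ)) ≤ η / 2 := by
            have h0 : V + (m + δ) + (m + δ) ≤ V + 2 * m + 2 :=
              calc V + (m + δ) + (m + δ) ≤ V + (m + 1) + (m + 1) := by gcongr
                _ = V + 2 * m + 2 := by ring
            calc ε * (V + (m + δ) + (m + δ)) ≤ ε * (V + 2 * m + 2) := mul_le_mul' le_rfl h0
              _ = η / 2 := by rw [hε]; field_simp
          have h2 : C * δ ≤ η / 2 := by
            calc C * δ ≤ (C + 1) * (η / 2 / (C + 1)) :=
                  mul_le_mul' le_self_add (min_le_right _ _)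
              _ = η / 2 := by field_simp
          calc ε * (V + (m + δ) + (m + δ)) + C * (m + δ)
              = ε * (V + (m + δ) + (m + δ)) + C * δ + C * m := by ring
            _ ≤ η / 2 + η / 2 + C * m := by gcongr
            _ = η + C * m := by rw [add_halves]
      _ = _ := by push_cast; rfl
  exact (ENNReal.add_le_add_iff_right (by finiteness)).1 hbound

/-- Competitors: `u ∈ W^{1,r}(U)` with `u = f` on `∂Ω` and `∇u = 0` in `Z`. -/
def IsCompetitor (r : ℝ) (Ω U Z : Set (E n)) (f u : E n → ℝ) : Prop :=
  MemW r U u ∧ MemWZeroOn r Ω U (u - f) ∧ ∀ᵐ x ∂(volume.restrict Z), ‖weakGradient U u x‖ = 0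

/-- The direct method: a minimizing sequence for a uniformly convex energy is a Cauchy sequence. -/
theorem hasUniqueMinimizer_of_isUniformlyConvexEnergy {r : ℝ} (hr : 1 < r) {Ω U S Z : Set (E n)}
    (hU : IsOpen U) (hb : Bornology.IsBounded U) (hP : HasPoincare r Ω U)
    {σ : E n → ℝ → EReal} (hE : IsUniformlyConvexEnergy r S σ) (hSU : S ⊆ U) (hZU : Z ⊆ U)
    (hcov : volume (U \ (S ∪ Z)) = 0) {f u₀ : E n → ℝ} (hu₀ : IsCompetitor r Ω U Z f u₀)
    (hfin : energyOn σ S (weakGradient U u₀) ≠ ⊤) :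
    HasUniqueMinimizer U (IsCompetitor r Ω U Z f) fun u => energyOn σ S (weakGradient U u) := by
  have hr0 : 0 < r := by linarith
  have hr' : 1 ≤ ENNReal.ofReal r := by simpa using hr.le
  have hfinU : IsFiniteMeasure (volume.restrict U) := ⟨by simpa using hb.measure_lt_top⟩
  have hSfin : volume S ≠ ⊤ := (hb.subset hSU).measure_lt_top.ne
  have hrS : volume.restrict S ≤ volume.restrict U := Measure.restrict_mono hSU le_rfl
  have hrZ : volume.restrict Z ≤ volume.restrict U := Measure.restrict_mono hZU le_rfl
  obtain ⟨CP, hCP⟩ := hP.eLpNorm_le hU hb hr.le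
  set J : (E n → ℝ) → ℝ≥0∞ := fun u => energyOn σ S (weakGradient U u) with hJ
  have hGm : ∀ u, IsCompetitor r Ω U Z f u →
      MemLp (weakGradient U u) (ENNReal.ofReal r) (volume.restrict U) :=
    fun u hu => hu.1.memLp_weakGradient hU
  set m : ℝ≥0∞ := ⨅ u, ⨅ _ : IsCompetitor r Ω U Z f u, J u with hm
  have hmle : ∀ u, IsCompetitor r Ω U Z f u → m ≤ J u := fun u hu => iInf₂_le u hu
  have hmfin : m ≠ ⊤ := ne_top_of_le_ne_top hfin (hmle u₀ hu₀)
  -- the midpoint of two competitors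
  have hmid : ∀ u v, IsCompetitor r Ω U Z f u → IsCompetitor r Ω U Z f v →
      m ≤ energyOn σ S ((2⁻¹ : ℝ) • (weakGradient U u + weakGradient U v)) := by
    intro u v hu hv
    have hg : weakGradient U ((2⁻¹ : ℝ) • (u + v)) =ᵐ[volume.restrict U]
        (2⁻¹ : ℝ) • (weakGradient U u + weakGradient U v) := by
      refine ((hu.1.add hU hv.1).weakGradient_const_smul hU _).trans ?_
      filter_upwards [hu.1.weakGradient_add hU hv.1] with x hx
      simp [hx]
    have hw : (2⁻¹ : ℝ) • (u + v) - f = (2⁻¹ : ℝ) • ((u - f) + (v - f)) := by module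
    have hcomp : IsCompetitor r Ω U Z f ((2⁻¹ : ℝ) • (u + v)) := by
      refine ⟨(hu.1.add hU hv.1).const_smul hU _, ?_, ?_⟩
      · rw [hw]
        exact (hu.2.1.add hU hb hr.le hv.2.1).const_smul hU hb _
      · filter_upwards [hu.2.2, hv.2.2, ae_mono hrZ hg] with x h1 h2 h3
        rw [norm_eq_zero] at h1 h2
        rw [h3, Pi.smul_apply, Pi.add_apply, h1, h2, add_zero, smul_zero, norm_zero]
    refine (hmle _ hcomp).trans (le_of_eq (lintegral_congr_ae ?_))
    filter_upwards [ae_mono hrS hg] with x hx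
    rw [hx]
  have hclose : ∀ η : NNReal, η ≠ 0 → ∃ δ : NNReal, δ ≠ 0 ∧ ∀ u v, IsCompetitor r Ω U Z f u →
      IsCompetitor r Ω U Z f v → J u ≤ m + δ → J v ≤ m + δ →
      eLpNorm (weakGradient U u - weakGradient U v) (ENNReal.ofReal r) (volume.restrict U) ≤ η ∧
      eLpNorm (u - v) (ENNReal.ofReal r) (volume.restrict U) ≤ CP * η := by
    intro η hη
    obtain ⟨δ, hδ, h⟩ := hE.lintegral_le hSfin hmfin (η := η ^ r)
      (NNReal.rpow_pos (pos_iff_ne_zero.2 hη)).ne'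
    refine ⟨δ, hδ, fun u v hu hv hJu hJv => ?_⟩
    have h1 := h _ _ ((hGm u hu).1.mono_measure hrS).aemeasurable
      ((hGm v hv).1.mono_measure hrS).aemeasurable (hmid u v hu hv) hJu hJv
    have h2 : eLpNorm (weakGradient U u - weakGradient U v) (ENNReal.ofReal r)
        (volume.restrict U) ≤ η := by
      rw [← ENNReal.rpow_le_rpow_iff hr0, eLpNorm_rpow_eq_lintegral hr0,
        ← ENNReal.coe_rpow_of_nonneg _ hr0.le]
      refine le_trans ?_ h1
      -- Both gradients vanish on `Z` and the rest of `U` is null, so the estimate on `S` controls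
      -- the whole of `U`.
      have hZ0 : ∫⁻ x in Z, ‖(weakGradient U u - weakGradient U v) x‖ₑ ^ r = 0 := by
        rw [← lintegral_zero]
        refine lintegral_congr_ae ?_
        filter_upwards [hu.2.2, hv.2.2] with x hx hx'
        rw [norm_eq_zero] at hx hx'
        simp [hx, hx', hr0]
      calc ∫⁻ x in U, ‖(weakGradient U u - weakGradient U v) x‖ₑ ^ r
          ≤ ∫⁻ x in (S ∪ Z) ∪ (U \ (S ∪ Z)), ‖(weakGradient U u - weakGradient U v) x‖ₑ ^ r :=
            lintegral_mono_set (by rw [union_sdiff_self]; exact subset_union_right)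
        _ ≤ (∫⁻ x in S ∪ Z, ‖(weakGradient U u - weakGradient U v) x‖ₑ ^ r) +
            ∫⁻ x in U \ (S ∪ Z), ‖(weakGradient U u - weakGradient U v) x‖ₑ ^ r :=
            lintegral_union_le _ _ _
        _ ≤ ((∫⁻ x in S, ‖(weakGradient U u - weakGradient U v) x‖ₑ ^ r) +
            ∫⁻ x in Z, ‖(weakGradient U u - weakGradient U v) x‖ₑ ^ r) + 0 :=
            add_le_add (lintegral_union_le _ _ _) (setLIntegral_measure_zero _ _ hcov).le
        _ = _ := by rw [hZ0, add_zero, add_zero]; rfl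
    refine ⟨h2, ?_⟩
    have h3 := (hu.2.1.sub hU hb hr.le hv.2.1)
    rw [sub_sub_sub_cancel_right] at h3
    refine (hCP _ h3).trans ?_
    rw [eLpNorm_congr_ae (hu.1.weakGradient_sub hU hv.1)]
    gcongr
  -- a minimizing sequence
  obtain ⟨us, hus, hJus⟩ : ∃ us : ℕ → E n → ℝ, (∀ k, IsCompetitor r Ω U Z f (us k)) ∧
      ∀ δ : NNReal, δ ≠ 0 → ∀ᶠ k in atTop, J (us k) ≤ m + δ := by
    have : ∀ k : ℕ, ∃ u, IsCompetitor r Ω U Z f u ∧ J u < m + (k + 1 : ℝ≥0∞)⁻¹ := fun k => by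
      have hlt : m < m + (k + 1 : ℝ≥0∞)⁻¹ :=
        ENNReal.lt_add_right hmfin (ENNReal.inv_ne_zero.2 (by finiteness))
      obtain ⟨u, hu⟩ := iInf_lt_iff.1 (hm ▸ hlt)
      obtain ⟨hc, hu⟩ := iInf_lt_iff.1 hu
      exact ⟨u, hc, hu⟩
    choose us hus hlt using this
    refine ⟨us, hus, fun δ hδ => ?_⟩
    have ht : Tendsto (fun k : ℕ => ((k + 1 : ℕ) : ℝ≥0∞)⁻¹) atTop (𝓝 0) :=
      ENNReal.tendsto_inv_nat_nhds_zero.comp (tendsto_add_atTop_nat 1)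
    filter_upwards [ht.eventually (gt_mem_nhds (show (0 : ℝ≥0∞) < δ by
      simpa using pos_iff_ne_zero.2 hδ))] with k hk
    refine (hlt k).le.trans ?_
    gcongr
    simpa using hk.le
  -- The exponent `N + 1` gives strict inequality with the summable bounds 2^(-N) demanded by
  -- `Lp.cauchy_complete_eLpNorm`.
  set η : ℕ → NNReal := fun N => (1 / 2) ^ (N + 1) with hη
  choose δ hδ hδc using fun N => hclose (η N) (by positivity)
  obtain ⟨ψ, hψ, hψJ⟩ := extraction_forall_of_eventually'
    (P := fun N k => ∀ a, k ≤ a → J (us a) ≤ m + δ N) fun N => by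
      obtain ⟨K, hK⟩ := eventually_atTop.1 (hJus (δ N) (hδ N))
      exact ⟨K, fun k hk a ha => hK a (hk.trans ha)⟩
  set vs : ℕ → E n → ℝ := fun k => us (ψ k) with hvs
  have hvc : ∀ k, IsCompetitor r Ω U Z f (vs k) := fun k => hus _
  have hvJ : ∀ N a, N ≤ a → J (vs a) ≤ m + δ N := fun N a h => hψJ N _ (hψ.monotone h)
  have hηlt : ∀ N, (η N : ℝ≥0∞) < (2⁻¹ : ℝ≥0∞) ^ N := fun N => by
    rw [hη]
    push_cast
    rw [pow_succ, one_div]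
    calc (2⁻¹ : ℝ≥0∞) ^ N * 2⁻¹ < (2⁻¹ : ℝ≥0∞) ^ N * 1 := by
          refine ENNReal.mul_lt_mul_right (by simp) (by finiteness) ?_
          exact ENNReal.inv_lt_one.2 (by norm_num)
      _ = _ := mul_one _
  have hsum : ∑' N : ℕ, (2⁻¹ : ℝ≥0∞) ^ N ≠ ⊤ := by
    rw [ENNReal.tsum_geometric, ENNReal.one_sub_inv_two, inv_inv]; simp
  obtain ⟨G, hGL, hGt⟩ := Lp.cauchy_complete_eLpNorm hr' (fun k => hGm _ (hvc k)) hsum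
    fun N a b ha hb' => ((hδc N _ _ (hvc a) (hvc b) (hvJ N a ha) (hvJ N b hb')).1).trans_lt
      (hηlt N)
  obtain ⟨u, huL, hut⟩ := Lp.cauchy_complete_eLpNorm (p := ENNReal.ofReal r)
    (μ := volume.restrict U) (f := vs) hr' (fun k => (hvc k).1.1)
    (B := fun N => (CP + 1) * (2⁻¹ : ℝ≥0∞) ^ N)
    (by rw [ENNReal.tsum_mul_left]; exact ENNReal.mul_ne_top (by finiteness) hsum)
    fun N a b ha hb' => by
      refine ((hδc N _ _ (hvc a) (hvc b) (hvJ N a ha) (hvJ N b hb')).2).trans_lt ?_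
      calc (CP : ℝ≥0∞) * η N ≤ (CP + 1) * η N := by gcongr; exact le_self_add
        _ < _ := ENNReal.mul_lt_mul_right (by simp) (by finiteness) (hηlt N)
  have hwg : HasWeakGradient U u G := HasWeakGradient.of_tendsto hr'
    (fun k => (hvc k).1.hasWeakGradient) (fun k => (hvc k).1.1) (fun k => hGm _ (hvc k)) huL hGL
    hut hGt
  have huW : MemW r U u := ⟨huL, G, hwg, hGL⟩
  have hugr : weakGradient U u =ᵐ[volume.restrict U] G := hwg.weakGradient_ae_eq hU
  obtain ⟨ns, hns, hae⟩ := (tendstoInMeasure_of_tendsto_eLpNorm (by simpa using hr0)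
    (fun k => (hGm _ (hvc k)).1) hGL.1 hGt).exists_seq_tendsto_ae
  -- `f` itself is not assumed to be in W^{1,r}(U), so the difference is routed through the known
  -- competitor `u₀`.
  have hfdiff : MemW r U (u - f) := by
    have : u - f = (u - u₀) + (u₀ - f) := by module
    rw [this]
    exact (huW.sub hU hu₀.1).add hU hu₀.2.1.1
  have hucomp : IsCompetitor r Ω U Z f u := by
    refine ⟨huW, MemWZeroOn.of_forall_exists hU hb hr.le hfdiff fun ε hε => ?_, ?_⟩
    · have ht : Tendsto (fun k => eLpNorm (vs k - u) (ENNReal.ofReal r) (volume.restrict U) +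
          eLpNorm (weakGradient U (vs k) - G) (ENNReal.ofReal r) (volume.restrict U)) atTop
          (𝓝 (0 + 0)) := hut.add hGt
      rw [add_zero] at ht
      obtain ⟨k, hk⟩ := (ht.eventually (gt_mem_nhds hε)).exists
      refine ⟨vs k - f, (hvc k).2.1, ?_⟩
      rw [sub_sub_sub_cancel_right, sobolevNorm, eLpNorm_sub_comm,
        eLpNorm_congr_ae (huW.weakGradient_sub hU (hvc k).1), eLpNorm_sub_comm (weakGradient U u),
        eLpNorm_congr_ae ((EventuallyEq.refl _ (weakGradient U (vs k))).sub hugr)]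
      exact hk
    · have h1 : ∀ᵐ x ∂(volume.restrict Z), ∀ k, ‖weakGradient U (vs k) x‖ = 0 :=
        ae_all_iff.2 fun k => (hvc k).2.2
      filter_upwards [h1, ae_mono hrZ hae, ae_mono hrZ hugr] with x hx1 hx2 hx3
      rw [hx3]
      refine tendsto_nhds_unique hx2.norm ?_
      simp only [hx1]
      exact tendsto_const_nhds
  have hJtend : Tendsto (fun k => J (vs (ns k))) atTop (𝓝 m) := by
    refine tendsto_order.2 ⟨fun a ha => Eventually.of_forall fun k =>
      ha.trans_le (hmle _ (hvc _)), fun a ha => ?_⟩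
    obtain ⟨d, hd0, hd⟩ := ENNReal.lt_iff_exists_add_pos_lt.1 ha
    have h1 := (hψ.tendsto_atTop.comp hns.tendsto_atTop).eventually (hJus d hd0.ne')
    filter_upwards [h1] with k hk
    exact hk.trans_lt hd
  have hJu : J u ≤ m := by
    -- Along a subsequence the gradients converge a.e.; continuity of the density and Fatou's lemma
    -- then give lower semicontinuity.
    have h1 : J u ≤ ∫⁻ x in S, liminf (fun k => energyDensity σ x ‖weakGradient U (vs (ns k)) x‖)
        atTop := by
      refine lintegral_mono_ae ?_
      filter_upwards [hE.continuousOn, ae_mono hrS hae, ae_mono hrS hugr] with x hx1 hx2 hx3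
      rw [hx3]
      have h2 := (hx1 _ (norm_nonneg (G x))).tendsto.comp
        (tendsto_nhdsWithin_iff.2 ⟨hx2.norm, Eventually.of_forall fun k => norm_nonneg _⟩)
      exact h2.liminf_eq.ge
    refine h1.trans ((lintegral_liminf_le' fun k => hE.aemeasurable _
      ((hGm _ (hvc _)).1.mono_measure hrS).aemeasurable).trans ?_)
    exact hJtend.liminf_eq.le
  refine ⟨u, ⟨hucomp, hJu.trans_lt (lt_top_iff_ne_top.2 hmfin),
    fun v hv => hJu.trans (hmle v hv)⟩, fun v hv => ?_⟩
  -- Two minimizers have energy at most `m + δ` for every δ, so `hclose` makes their distance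
  -- smaller than any ε.
  have hzero : eLpNorm (v - u) (ENNReal.ofReal r) (volume.restrict U) = 0 := by
    refine le_antisymm (ENNReal.le_of_forall_pos_le_add fun ε hε _ => ?_) zero_le
    obtain ⟨d, -, hd⟩ := hclose (ε / (CP + 1)) (by positivity)
    refine ((hd v u hv.1 hucomp ((hv.2.2 u hucomp).trans (hJu.trans le_self_add))
      (hJu.trans le_self_add)).2).trans ?_
    rw [zero_add]
    norm_cast
    calc CP * (ε / (CP + 1)) ≤ (CP + 1) * (ε / (CP + 1)) := by gcongr; exact le_self_add
      _ = ε := by field_simp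
  rw [eLpNorm_eq_zero_iff (hv.1.1.1.sub huL).1 (by simpa using hr0)] at hzero
  filter_upwards [hzero] with x hx
  exact sub_eq_zero.1 hx

end DirectMethod

/-! ### Competitors of finite energy and the four cases. -/

section Main

variable {n : ℕ} {Ω A : Set (E n)}

/-- Removing the inclusion makes B equal to Ω, which yields the Poincaré inequality on all of Ω. -/
theorem IsTwoPhaseDomain.empty (h : IsTwoPhaseDomain Ω A) : IsTwoPhaseDomain Ω ∅ where
  isOpen := h.isOpen
  isConnected := h.isConnected
  isBounded := h.isBounded
  lipschitz := h.lipschitz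
  isOpen_inner := isOpen_empty
  closure_inner_subset := by simp
  lipschitz_inner := by simp [HasLipschitzBoundary]
  finite_components := Quotient.finite _
  isConnected_outer := by simpa [outerPhase] using h.isConnected

theorem IsTwoPhaseDomain.hasPoincare_whole (hn : n ≠ 0) {p : ℝ} (hp : 1 ≤ p)
    (h : IsTwoPhaseDomain Ω A) : HasPoincare p Ω Ω := by
  have := h.empty.hasPoincare hn hp
  rwa [outerPhase, closure_empty, sdiff_empty] at this

/-- The part of Ω outside both phases lies in ∂A, which is null. -/
theorem IsTwoPhaseDomain.volume_diff (h : IsTwoPhaseDomain Ω A) :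
    volume (Ω \ (outerPhase Ω A ∪ A)) = 0 := by
  refine measure_mono_null ?_ (h.lipschitz_inner.volume_frontier h.isOpen_inner)
  rintro x ⟨hxΩ, hx⟩
  rw [h.isOpen_inner.frontier_eq]
  exact ⟨by_contra fun hc => hx (Or.inl ⟨hxΩ, hc⟩), fun hA => hx (Or.inr hA)⟩

theorem exists_smooth_cutoff (hΩ : IsOpen Ω) (hb : Bornology.IsBounded Ω) {K : Set (E n)}
    (hK : IsClosed K) (hKΩ : K ⊆ Ω) :
    ∃ χ : E n → ℝ, ContDiff ℝ (⊤ : ℕ∞) χ ∧ HasCompactSupport χ ∧ tsupport χ ⊆ Ω ∧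
      ∀ x ∈ K, χ x = 1 := by
  obtain ⟨V, hV, hKV, hVΩ⟩ := normal_exists_closure_subset hK hΩ hKΩ
  obtain ⟨χ, hχ, -, hsupp, hone⟩ := exists_contMDiff_support_eq_eq_one_iff
    (modelWithCornersSelf ℝ (E n)) (n := (⊤ : ℕ∞)) hV hK hKV
  have hts : tsupport χ ⊆ closure V := closure_mono hsupp.subset
  refine ⟨χ, hχ.contDiff, ?_, hts.trans hVΩ, fun x hx => (hone x).1 hx⟩
  exact Metric.isCompact_of_isClosed_isBounded (isClosed_tsupport χ)
    (hb.subset (hts.trans hVΩ))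

/-- The definition of the trace supplies smooth functions approximating `f` in W^{1,p}(Ω). Their
products with χ are C¹_c(Ω) functions approximating χf, as multiplication by χ is bounded. -/
theorem memWZero_smooth_mul (hΩ : IsOpen Ω) {p : ℝ} (hp : 1 ≤ p)
    (hb : Bornology.IsBounded Ω) {f : E n → ℝ} (hf : MemXDiamond p Ω f) {χ : E n → ℝ}
    (hχ : ContDiff ℝ (⊤ : ℕ∞) χ) (hc : HasCompactSupport χ) (hs : tsupport χ ⊆ Ω) :
    MemWZero p Ω fun x => χ x * f x := by
  obtain ⟨hfW, g, ⟨-, hg⟩, -⟩ := hf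
  obtain ⟨C, hC⟩ := MemW.smooth_mul hΩ hp hχ hc
  refine ⟨(hC f hfW).1, fun ε hε => ?_⟩
  obtain ⟨φ, hφ, hlt, -⟩ := hg (ε / (C + 1)) (ENNReal.div_pos hε.ne' (by finiteness))
  have hφ1 : ContDiff ℝ 1 φ := hφ.of_le (by exact_mod_cast le_top)
  refine ⟨fun x => χ x * φ x, (hχ.of_le (by exact_mod_cast le_top)).mul hφ1, hc.mul_right,
    (closure_mono (Function.support_mul_subset_left _ _)).trans hs, ?_⟩
  have heq : (fun x => χ x * f x) - (fun x => χ x * φ x) = fun x => χ x * (f - φ) x := by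
    ext x
    simp [mul_sub]
  rw [heq]
  refine ((hC _ (hfW.sub hΩ (MemW.of_contDiff hb hφ1))).2).trans_lt ?_
  rw [ENNReal.lt_div_iff_mul_lt (by simp) (by simp)] at hlt
  refine lt_of_le_of_lt ?_ hlt
  rw [mul_comm]
  gcongr
  exact le_self_add

theorem energyDensity_zero (σ : E n → ℝ → EReal) (x : E n) : energyDensity σ x 0 = 0 := by
  simp [energyDensity]

theorem energyOn_ne_top {p : ℝ} (hp : 1 < p) {S : Set (E n)} (hS : volume S ≠ ⊤)
    {σ : E n → ℝ → EReal} (hc : IsCaratheodory S σ) (hg : HasGrowth p S σ) {G : E n → E n}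
    (hG : MemLp G (ENNReal.ofReal p) (volume.restrict S)) : energyOn σ S G ≠ ⊤ := by
  have hp0 : 0 < p := by linarith
  obtain ⟨C, hC⟩ := energyDensity_le hp hc hg
  have hfin : ∫⁻ x in S, ‖G x‖ₑ ^ p ≠ ⊤ := by
    rw [← eLpNorm_rpow_eq_lintegral hp0]
    exact ENNReal.rpow_ne_top_of_nonneg hp0.le hG.2.ne
  refine ne_top_of_le_ne_top (b := C * (volume S + ∫⁻ x in S, ‖G x‖ₑ ^ p)) (by finiteness) ?_
  rw [← setLIntegral_one, ← lintegral_add_left measurable_const,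
    ← lintegral_const_mul' _ _ ENNReal.coe_ne_top]
  refine lintegral_mono_ae ?_
  filter_upwards [hC] with x hx
  exact hx (G x)

/-- An extension of the boundary datum that vanishes in `A` and has finite energy. -/
theorem exists_extension {p : ℝ} (hp : 1 < p) (hΩA : IsTwoPhaseDomain Ω A)
    {σ : E n → ℝ → EReal} (hc : IsCaratheodory (outerPhase Ω A) σ)
    (hg : HasGrowth p (outerPhase Ω A) σ) {f : E n → ℝ} (hf : MemXDiamond p Ω f) :
    ∃ u, MemW p Ω u ∧ MemWZero p Ω (u - f) ∧
      (∀ᵐ x ∂(volume.restrict A), weakGradient Ω u x = 0) ∧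
      energyOn σ (outerPhase Ω A) (weakGradient Ω u) ≠ ⊤ := by
  have hΩ := hΩA.isOpen
  have hb := hΩA.isBounded
  obtain ⟨χ, hχ, hχc, hχs, hχ1⟩ := exists_smooth_cutoff hΩ hb isClosed_closure
    hΩA.closure_inner_subset
  have h0 := memWZero_smooth_mul hΩ hp.le hb hf hχ hχc hχs
  have hu : MemW p Ω (f - fun x => χ x * f x) := hf.1.sub hΩ h0.1
  -- Subtracting χf leaves the boundary values unchanged and makes the function zero in A, where 0
  -- is therefore its weak gradient.
  refine ⟨f - fun x => χ x * f x, hu, ?_, ?_, ?_⟩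
  · have h1 := MemWZeroOn.const_smul hΩ hb h0 (-1)
    have h2 : (f - fun x => χ x * f x) - f = (-1 : ℝ) • fun x => χ x * f x := by
      ext x; simp
    rw [h2]
    exact h1
  · have hAΩ : A ⊆ Ω := subset_closure.trans hΩA.closure_inner_subset
    have hz : ∀ x ∈ A, (f - fun x => χ x * f x) x = 0 := fun x hx => by
      simp [hχ1 x (subset_closure hx)]
    have hzero : HasWeakGradient A (f - fun x => χ x * f x) 0 := by
      refine ⟨hu.hasWeakGradient.1.mono_set hAΩ, ?_, fun φ _ _ _ v => ?_⟩
      · exact (locallyIntegrable_const (0 : E n)).locallyIntegrableOn A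
      · rw [setIntegral_eq_zero_of_forall_eq_zero fun x hx => by rw [hz x hx, zero_mul]]
        simp
    exact (hu.hasWeakGradient.mono hAΩ hΩ.measurableSet).ae_eq hΩA.isOpen_inner hzero
  · exact energyOn_ne_top hp (hb.subset sdiff_subset).measure_lt_top.ne hc hg
      ((hu.memLp_weakGradient hΩ).mono_measure (Measure.restrict_mono sdiff_subset le_rfl))

/-- On a bounded domain the spaces decrease with the exponent, so each union in the definition is
the space of exponent `min p q`. -/
theorem admissibleTwoPhase_iff {p q : ℝ} (hp : 1 < p) (hq : 1 < q) (hΩ : IsOpen Ω)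
    (hb : Bornology.IsBounded Ω) (f u : E n → ℝ) :
    AdmissibleTwoPhase p q Ω f u ↔ IsCompetitor (min p q) Ω Ω ∅ f u := by
  have hfin : IsFiniteMeasure (volume.restrict Ω) := ⟨by simpa using hb.measure_lt_top⟩
  have hr : 0 < min p q := lt_min (by linarith) (by linarith)
  constructor
  · rintro ⟨h1, h2⟩
    exact ⟨h1.elim (fun h => h.mono_exponent hΩ (min_le_left p q))
        (fun h => h.mono_exponent hΩ (min_le_right p q)),
      h2.elim (fun h => MemWZeroOn.mono_exponent hΩ hb hr (min_le_left p q) h)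
        (fun h => MemWZeroOn.mono_exponent hΩ hb hr (min_le_right p q) h), by simp⟩
  · rintro ⟨h1, h2, -⟩
    rcases le_total p q with h | h
    · rw [min_eq_left h] at h1 h2
      exact ⟨Or.inl h1, Or.inl h2⟩
    · rw [min_eq_right h] at h1 h2
      exact ⟨Or.inr h1, Or.inr h2⟩

theorem energyTwoPhase_eq (hA : IsOpen A) (σ : E n → ℝ → EReal) (u : E n → ℝ) :
    energyTwoPhase Ω A σ u = energyOn σ (outerPhase Ω A ∪ A) (weakGradient Ω u) := by
  rw [energyTwoPhase, energyOn, energyOn, energyOn, lintegral_union hA.measurableSet]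
  exact Set.disjoint_left.2 fun x hx hxA => hx.2 (subset_closure hxA)

theorem hasUniqueMinimizer_twoPhase (hn : n ≠ 0) {p q : ℝ} (hp : 1 < p) (hq : 1 < q)
    (hΩA : IsTwoPhaseDomain Ω A) {σ : E n → ℝ → EReal}
    (hcB : IsCaratheodory (outerPhase Ω A) σ) (hcA : IsCaratheodory A σ)
    (hgB : HasGrowth p (outerPhase Ω A) σ) (hmB : IsStronglyMonotone p (outerPhase Ω A) σ)
    (hgA : HasGrowth q A σ) (hmA : IsStronglyMonotone q A σ) {f : E n → ℝ}
    (hf : MemXDiamond p Ω f) :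
    HasUniqueMinimizer Ω (AdmissibleTwoPhase p q Ω f) (energyTwoPhase Ω A σ) := by
  have hr : 1 < min p q := lt_min hp hq
  have hadm : AdmissibleTwoPhase p q Ω f = IsCompetitor (min p q) Ω Ω ∅ f := by
    ext u
    exact admissibleTwoPhase_iff hp hq hΩA.isOpen hΩA.isBounded f u
  have hJ : energyTwoPhase Ω A σ =
      fun u => energyOn σ (outerPhase Ω A ∪ A) (weakGradient Ω u) := by
    ext u
    exact energyTwoPhase_eq hΩA.isOpen_inner σ u
  obtain ⟨u, huW, hu0, huA, hufin⟩ := exists_extension hp hΩA hcB hgB hf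
  have hE := (isUniformlyConvexEnergy (by linarith) (min_le_left p q) hp hcB hgB hmB).union
    (isUniformlyConvexEnergy (by linarith) (min_le_right p q) hq hcA hgA hmA)
  have hfin : energyOn σ (outerPhase Ω A ∪ A) (weakGradient Ω u) ≠ ⊤ := by
    have hA0 : energyOn σ A (weakGradient Ω u) = 0 := by
      rw [energyOn, ← lintegral_zero]
      refine lintegral_congr_ae ?_
      filter_upwards [huA] with x hx
      rw [hx, norm_zero, energyDensity_zero]
    rw [← energyTwoPhase_eq hΩA.isOpen_inner, energyTwoPhase, hA0, add_zero]
    exact hufin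
  rw [hJ]
  rw [hadm]
  exact hasUniqueMinimizer_of_isUniformlyConvexEnergy hr hΩA.isOpen hΩA.isBounded
    (hΩA.hasPoincare_whole hn hr.le) hE
    (union_subset sdiff_subset (subset_closure.trans hΩA.closure_inner_subset))
    (empty_subset _) (by rw [union_empty]; exact hΩA.volume_diff)
    (hadm ▸ (⟨Or.inl huW, Or.inl hu0⟩ : AdmissibleTwoPhase p q Ω f u)) hfin

theorem hasUniqueMinimizer_PEI (hn : n ≠ 0) {p : ℝ} (hp : 1 < p) (hΩA : IsTwoPhaseDomain Ω A)
    {σ : E n → ℝ → EReal} (hcB : IsCaratheodory (outerPhase Ω A) σ)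
    (hgB : HasGrowth p (outerPhase Ω A) σ) (hmB : IsStronglyMonotone p (outerPhase Ω A) σ)
    {f : E n → ℝ} (hf : MemW p Ω f) :
    HasUniqueMinimizer (outerPhase Ω A) (AdmissiblePEI p Ω A f) (energyPEI Ω A σ) := by
  have hB : IsOpen (outerPhase Ω A) := hΩA.isOpen.sdiff isClosed_closure
  have hb : Bornology.IsBounded (outerPhase Ω A) := hΩA.isBounded.subset sdiff_subset
  have hfB : MemW p (outerPhase Ω A) f := hf.mono_set hΩA.isOpen sdiff_subset
  have hadm : AdmissiblePEI p Ω A f = IsCompetitor p Ω (outerPhase Ω A) ∅ f := by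
    ext u
    simp [AdmissiblePEI, IsCompetitor]
  have hf0 : MemWZeroOn p Ω (outerPhase Ω A) (f - f) := by
    refine ⟨hfB.sub hB hfB, fun ε hε => ⟨0, contDiff_const, HasCompactSupport.zero, by simp, ?_⟩⟩
    rw [sub_self, sub_self, ← zero_smul ℝ f, MemW.sobolevNorm_const_smul hB hfB]
    simpa using hε
  rw [hadm]
  exact hasUniqueMinimizer_of_isUniformlyConvexEnergy hp hB hb (hΩA.hasPoincare hn hp.le)
    (isUniformlyConvexEnergy (by linarith) le_rfl hp hcB hgB hmB) subset_rfl (empty_subset _)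
    (by simp) ⟨hfB, hf0, by simp⟩
    (energyOn_ne_top hp hb.measure_lt_top.ne hcB hgB (hfB.memLp_weakGradient hB))

/-- The case `Z = A`: the energy sees only B, and the gradient constraint supplies the missing
control in A. -/
theorem hasUniqueMinimizer_PEC (hn : n ≠ 0) {p : ℝ} (hp : 1 < p) (hΩA : IsTwoPhaseDomain Ω A)
    {σ : E n → ℝ → EReal} (hcB : IsCaratheodory (outerPhase Ω A) σ)
    (hgB : HasGrowth p (outerPhase Ω A) σ) (hmB : IsStronglyMonotone p (outerPhase Ω A) σ)
    {f : E n → ℝ} (hf : MemXDiamond p Ω f) :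
    HasUniqueMinimizer Ω (AdmissiblePEC p Ω A f) (energyPEC Ω A σ) := by
  obtain ⟨u, huW, hu0, huA, hufin⟩ := exists_extension hp hΩA hcB hgB hf
  exact hasUniqueMinimizer_of_isUniformlyConvexEnergy (Z := A) hp hΩA.isOpen hΩA.isBounded
    (hΩA.hasPoincare_whole hn hp.le)
    (isUniformlyConvexEnergy (by linarith) le_rfl hp hcB hgB hmB) sdiff_subset
    (subset_closure.trans hΩA.closure_inner_subset) hΩA.volume_diff
    ⟨huW, hu0, by filter_upwards [huA] with x hx; rw [hx, norm_zero]⟩ hufin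

end Main

end TwoPhase

theorem theorem2p1 (n : ℕ) (hn : 2 ≤ n) (p q : ℝ) (hp : 1 < p) (hq : 1 < q)
    (Ω A : Set (TwoPhase.E n)) (hΩA : TwoPhase.IsTwoPhaseDomain Ω A)
    (σ : TwoPhase.E n → ℝ → EReal)
    (hP1 : TwoPhase.IsCaratheodory (TwoPhase.outerPhase Ω A) σ ∧ TwoPhase.IsCaratheodory A σ)
    (hP2 : TwoPhase.HasGrowth p (TwoPhase.outerPhase Ω A) σ)
    (hP3 : TwoPhase.IsStronglyMonotone p (TwoPhase.outerPhase Ω A) σ)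
    (f : TwoPhase.E n → ℝ) (hf : TwoPhase.MemXDiamond p Ω f) :
    (A = ∅ → TwoPhase.HasUniqueMinimizer Ω
      (TwoPhase.AdmissibleTwoPhase p q Ω f) (TwoPhase.energyTwoPhase Ω A σ)) ∧
    (TwoPhase.HasGrowth q A σ → TwoPhase.IsStronglyMonotone q A σ →
      TwoPhase.HasUniqueMinimizer Ω
        (TwoPhase.AdmissibleTwoPhase p q Ω f) (TwoPhase.energyTwoPhase Ω A σ)) ∧
    (TwoPhase.IsPEI A σ → TwoPhase.HasUniqueMinimizer (TwoPhase.outerPhase Ω A)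
      (TwoPhase.AdmissiblePEI p Ω A f) (TwoPhase.energyPEI Ω A σ)) ∧
    (TwoPhase.IsPEC A σ → TwoPhase.HasUniqueMinimizer Ω
      (TwoPhase.AdmissiblePEC p Ω A f) (TwoPhase.energyPEC Ω A σ)) := by
  have hn0 : n ≠ 0 := by omega
  refine ⟨fun hA => ?_, fun hgA hmA => ?_, fun _ => ?_, fun _ => ?_⟩
  -- For empty A the assumptions on A hold vacuously with arbitrary constants, so this is a special
  -- case of two phases.
  · refine TwoPhase.hasUniqueMinimizer_twoPhase hn0 hp hq hΩA hP1.1 hP1.2 hP2 hP3 ?_ ?_ hf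
    · exact ⟨1, 1, 1, one_pos, le_rfl, one_pos, by simp [hA]⟩
    · exact ⟨1, one_pos, by simp [hA]⟩
  · exact TwoPhase.hasUniqueMinimizer_twoPhase hn0 hp hq hΩA hP1.1 hP1.2 hP2 hP3 hgA hmA hf
  · exact TwoPhase.hasUniqueMinimizer_PEI hn0 hp hΩA hP1.1 hP2 hP3 hf.1
  · exact TwoPhase.hasUniqueMinimizer_PEC hn0 hp hΩA hP1.1 hP2 hP3 hf
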